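/- Let $M$ be a connected smooth manifold with a smooth transitive action of a (second countable, finite-dimensional, real) Lie group $G$, and let $H$ be the isotropy group of a point, so that $M=G/H$. Assume that this presentation is almost effective, i.e. that the ineffective kernel $\{a\in G : a\cdot x=x \text{ for all } x\in M\}=\bigcap_{a\in G} aHa^{-1}$ is finite. A homogeneous Ricci flow on a time interval $J$ is a family $(g(t))_{t\in J}$ of smooth $G$-invariant Riemannian metrics on $M$ with $\frac{\partial}{\partial t} g(t)=-2\,\mathrm{ric}(g(t))$. Let $K$ be a compact normal Lie subgroup of $G$. (1) If $K$ is non-abelian, and $K$ or $G$ is connected, then for every initial $G$-invariant metric $g_0$ on $M$ the homogeneous Ricci flow has finite extinction time: there is $T_0<\infty$, depending on $g_0$, such that every homogeneous Ricci flow $g(t)$, $t\in[0,T)$, with $g(0)=g_0$ satisfies $T\le T_0$. (2) If there is an immortal homogeneous Ricci flow on $M=G/H$, i.e. one defined for all $t\in[0,\infty)$, then $K$ is not semisimple, i.e. the Lie algebra of $K$ is not a non-zero semisimple Lie algebra. In other words, $G$ has no compact semisimple normal subgroup. -/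

import Mathlib

open scoped Manifold ContDiff

noncomputable section

namespace HomRicci

/-! ## Curvature of a metric in coordinates

A Riemannian metric on an open piece of a finite-dimensional space `E` is given by its coefficient
function `G : E → E →L[ℝ] E →L[ℝ] ℝ`. -/

section Coordinates

variable {E : Type*} [NormedAddCommGroup E] [NormedSpace ℝ E]

/-- The Christoffel symbols of the first kind: for constant vector fields `u`, `v`, `w`, this is
`g(∇_u v, w) = (∂_u g(v, w) + ∂_v g(u, w) - ∂_w g(u, v)) / 2`, as a linear form in `w`. -/
def christoffelFirst (G : E → E →L[ℝ] E →L[ℝ] ℝ) (y u v : E) : E →L[ℝ] ℝ :=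
  (1 / 2 : ℝ) • (fderiv ℝ G y u v + fderiv ℝ G y v u - ((fderiv ℝ G y).flip u).flip v)

theorem christoffelFirst_apply (G : E → E →L[ℝ] E →L[ℝ] ℝ) (y u v w : E) :
    christoffelFirst G y u v w =
      (1 / 2 : ℝ) * (fderiv ℝ G y u v w + fderiv ℝ G y v u w - fderiv ℝ G y w u v) := by
  simp [christoffelFirst]

/-- The Christoffel symbols `Γ(u, v) = ∇_u v` (for constant `u`, `v`) of the Levi-Civita
connection: the index of `christoffelFirst` is raised with the inverse of the metric, the metric
`G y` being viewed as the isomorphism `E → E*` (see `metric_christoffel`). -/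
def christoffel (G : E → E →L[ℝ] E →L[ℝ] ℝ) (y u v : E) : E :=
  (G y).inverse (christoffelFirst G y u v)

theorem metric_christoffel (G : E → E →L[ℝ] E →L[ℝ] ℝ) (y : E) (h : (G y).IsInvertible)
    (u v w : E) :
    G y (christoffel G y u v) w =
      (1 / 2 : ℝ) * (fderiv ℝ G y u v w + fderiv ℝ G y v u w - fderiv ℝ G y w u v) := by
  rw [← christoffelFirst_apply]
  obtain ⟨e, he⟩ := h
  simp [christoffel, ← he]

/-- The Riemann curvature tensor `R(u, v) w = ∇_u ∇_v w - ∇_v ∇_u w` (for constant vector fields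
`u`, `v`, `w`). -/
def curvature (G : E → E →L[ℝ] E →L[ℝ] ℝ) (y u v w : E) : E :=
  fderiv ℝ (fun z => christoffel G z v w) y u - fderiv ℝ (fun z => christoffel G z u w) y v
    + christoffel G y u (christoffel G y v w) - christoffel G y v (christoffel G y u w)

/-- The Ricci tensor `ric(v, w) = tr (u ↦ R(u, v) w)` of a metric in coordinates; the trace is
written out in a basis of `E`. -/
def coordRicci [FiniteDimensional ℝ E] (G : E → E →L[ℝ] E →L[ℝ] ℝ) (y v w : E) : ℝ :=
  ∑ i, (Module.finBasis ℝ E).coord i (curvature G y (Module.finBasis ℝ E i) v w)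

end Coordinates

/-! ## Riemannian metrics on a manifold and the Ricci flow -/

section Manifold

variable {E : Type*} [NormedAddCommGroup E] [NormedSpace ℝ E] [FiniteDimensional ℝ E]
  {M : Type*} [TopologicalSpace M] [ChartedSpace E M] [IsManifold 𝓘(ℝ, E) ∞ M]

variable (E M) in
/-- Smooth Riemannian metrics on the manifold `M`. -/
abbrev Metric : Type _ :=
  Bundle.ContMDiffRiemannianMetric 𝓘(ℝ, E) ∞ E (fun x : M => TangentSpace 𝓘(ℝ, E) x)

/-- The coefficients of the metric `g` in the chart `φ` of `M` around `x`, that is, the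
pullback of `g` under `φ⁻¹`. -/
def metricInChart (g : Metric E M) (x : M) (y : E) : E →L[ℝ] E →L[ℝ] ℝ :=
  let A : E →L[ℝ] E := mfderiv 𝓘(ℝ, E) 𝓘(ℝ, E) (chartAt E x).symm y
  let B : E →L[ℝ] E →L[ℝ] ℝ := g.inner ((chartAt E x).symm y)
  B.bilinearComp A A

/-- The Ricci tensor of the Riemannian metric `g` at `x`, computed in the chart of `M` around
`x`. -/
def ricci (g : Metric E M) (x : M) (v w : TangentSpace 𝓘(ℝ, E) x) : ℝ :=
  coordRicci (metricInChart g x) (chartAt E x x)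
    (mfderiv 𝓘(ℝ, E) 𝓘(ℝ, E) (chartAt E x) x v) (mfderiv 𝓘(ℝ, E) 𝓘(ℝ, E) (chartAt E x) x w)

/-- The family of metrics `g t`, `t ∈ J`, solves the Ricci flow equation `∂g/∂t = -2 ric(g)`
on the time interval `J`. -/
def IsRicciFlowOn (J : Set ℝ) (g : ℝ → Metric E M) : Prop :=
  ∀ t ∈ J, ∀ (x : M) (v w : TangentSpace 𝓘(ℝ, E) x),
    HasDerivWithinAt (fun s => (g s).inner x v w) (-2 * ricci (g t) x v w) J t

variable (G : Type*) [Group G] [MulAction G M]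

/-- The metric `g` on `M` is `G`-invariant: every `a : G` acts on `(M, g)` by an isometry. -/
def IsInvariantMetric (g : Metric E M) : Prop :=
  ∀ (a : G) (x : M) (v w : TangentSpace 𝓘(ℝ, E) x),
    g.inner (a • x) (mfderiv 𝓘(ℝ, E) 𝓘(ℝ, E) (fun y : M => a • y) x v)
      (mfderiv 𝓘(ℝ, E) 𝓘(ℝ, E) (fun y : M => a • y) x w) = g.inner x v w

/-- A homogeneous Ricci flow on the time interval `J`: a Ricci flow by `G`-invariant metrics. -/
def IsHomogeneousRicciFlowOn (J : Set ℝ) (g : ℝ → Metric E M) : Prop :=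
  IsRicciFlowOn J g ∧ ∀ t ∈ J, IsInvariantMetric G (g t)

/-- The homogeneous Ricci flow starting at `g₀` has finite extinction time: its times of existence
are bounded. -/
def HasFiniteExtinctionTime (g₀ : Metric E M) : Prop :=
  ∃ T₀ : ℝ, ∀ (T : ℝ) (g : ℝ → Metric E M),
    IsHomogeneousRicciFlowOn G (Set.Ico 0 T) g → g 0 = g₀ → T ≤ T₀

/-- An immortal homogeneous Ricci flow: one that exists for all times `t ≥ 0`. -/
def IsImmortalHomogeneousRicciFlow (g : ℝ → Metric E M) : Prop :=
  IsHomogeneousRicciFlowOn G (Set.Ici 0) g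

end Manifold

/-- The action of `G` on `M` is almost effective: its ineffective kernel, which for a transitive
action with isotropy group `H` is `⋂ a, a H a⁻¹`, is finite. -/
def IsAlmostEffective (G M : Type*) [Group G] [MulAction G M] : Prop :=
  {a : G | ∀ x : M, a • x = x}.Finite

/-- A smooth Lie group is smooth enough for Mathlib's Lie bracket on its tangent space at `1`. -/
instance : ENat.LEInfty (minSmoothness ℝ 3) := ⟨by
  rw [minSmoothness_of_isRCLikeNormedField]
  exact ENat.LEInfty.out⟩

end HomRicci

end

/-!
# Homogeneous Ricci flows and compact normal subgroups

Let `K` be a compact normal subgroup of `G` whose Lie algebra `𝔨` is not abelian. For `X ∈ 𝔨`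
let `X*` be the fundamental vector field of `X` on `M`, the velocity of `k ↦ k • x` at the unit.
It is a Killing field of every `G`-invariant metric, so a homogeneous Ricci flow can be tested
on these fields, which do not depend on time.

*The fields.* Averaging over `K` gives an `ad`-invariant inner product on `𝔨`. Hence the Killing
form is negative definite on the derived algebra of `𝔨`, which is its own derived algebra; let
`X i` be an orthonormal basis of it for the negative of the Killing form
(`exists_invariant_family`, `exists_frame`). Conjugation by `a ∈ G` is a smooth automorphism of
`K` (`isSmoothAction_conjNormal`), its derivative at the unit permutes the fundamental fields
(`fundField_smul`) and, preserving the Killing form, acts orthogonally on the span of the `X i`.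
Since `G` is transitive, `∑ |X i*|²` is therefore constant on `M` for every invariant metric.

*The curvature.* For Killing fields `ξ i` such that `∑ |ξ i|²` is constant, `∑ ∇_{ξ i} ξ i`
vanishes and Bochner's formula reads `∑ ric(ξ i, ξ i) = ∑ |∇ ξ i|²` (`sum_coordRicci_eq`). The
right hand side is bounded below: each `X l*` is a combination, with constant coefficients, of
the brackets `∇_{X i*} X j* - ∇_{X j*} X i*`, so the `∇ X i*` cannot all be small
(`exists_pos_le_sum_trace`). Both sides of this comparison scale in the same way, so that the
bound is a positive constant `c` which depends on the structure coefficients only and not on the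
metric (`exists_pos_le_sum_ricci`). Almost effectiveness enters here: some `X i*` is nonzero, as
otherwise a one-parameter subgroup of `K` would act trivially
(`IsSmoothAction.infinite_kernel`).

*The flow.* At a fixed point of `M`, the sum `∑ g(t)(X i*, X i*)` is nonnegative with derivative
`-2 ∑ ric(X i*, X i*) ≤ -2 c`; this bounds the time of existence (`hasFiniteExtinctionTime`). In
particular there is no immortal flow if `𝔨` is semisimple and nonzero, since `𝔨` is then not
abelian.

*Connectedness.* If `𝔨` is abelian and `K` or `G` is connected, then `K` is abelian. The
connected group `L` in question acts smoothly on `K` by automorphisms. For `Z` in its Lie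
algebra, the velocity of `a ↦ (a • k) k⁻¹` in the direction `Z` is additive in `k` where the
adjoint representation of `K` is trivial, and bounded as `K` is compact; so it vanishes there
and `L` fixes such `k` (`act_eq_self`). These `k` include a neighbourhood of the unit, which is
thus central in `K`; so the adjoint representation is trivial on all of `K`
(`mul_comm_of_chartBracket_eq_zero`).

Derivatives are computed in charts. The Lie bracket of a Lie group appears as the
antisymmetrised second derivative of its multiplication (`lie_eq_chartBracket`), and the
fundamental fields and their brackets as first and second derivatives of the action.
-/

open scoped Manifold ContDiff

namespace HomRicci

set_option maxSynthPendingDepth 3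

/-! ### Skew endomorphisms and invariant families in a Lie algebra -/

section LinearAlgebra

open scoped InnerProductSpace

/-- A positive definite symmetric bilinear form, regarded as an inner product. -/
abbrev coreOfForm {F : Type*} [AddCommGroup F] [Module ℝ F] (B : F →ₗ[ℝ] F →ₗ[ℝ] ℝ)
    (hs : ∀ u v, B u v = B v u) (hp : ∀ v, v ≠ 0 → 0 < B v v) : InnerProductSpace.Core ℝ F where
  inner u v := B u v
  conj_inner_symm u v := by simp [hs u v]
  re_inner_nonneg v := by
    by_cases h : v = 0
    · simp [h]
    · simpa using (hp v h).le
  add_left u v w := by simp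
  smul_left u v r := by simp
  definite v h := by
    by_contra hv
    exact (hp v hv).ne' h

section InnerProduct

variable {F : Type*} [NormedAddCommGroup F] [InnerProductSpace ℝ F]

theorem sum_apply_self_orthonormalBasis {ι : Type*} [Fintype ι] (b b' : OrthonormalBasis ι ℝ F)
    (β : F →ₗ[ℝ] F →ₗ[ℝ] ℝ) : ∑ i, β (b' i) (b' i) = ∑ i, β (b i) (b i) := by
  have h1 : ∀ i, β (b' i) (b' i) =
      ∑ j, ∑ l, (⟪b j, b' i⟫_ℝ * ⟪b' i, b l⟫_ℝ) * β (b j) (b l) := by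
    intro i
    conv_lhs => rw [← b.sum_repr' (b' i)]
    simp only [map_sum, LinearMap.sum_apply, map_smul, LinearMap.smul_apply, smul_eq_mul,
      Finset.mul_sum]
    rw [Finset.sum_comm]
    refine Finset.sum_congr rfl fun j _ => Finset.sum_congr rfl fun l _ => ?_
    rw [real_inner_comm (b' i) (b l)]
    ring
  simp_rw [h1]
  rw [Finset.sum_comm]
  refine Finset.sum_congr rfl fun j _ => ?_
  rw [Finset.sum_comm]
  simp_rw [← Finset.sum_mul, b'.sum_inner_mul_inner]
  classical
  simp [b.inner_eq_ite]

variable [FiniteDimensional ℝ F]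

theorem trace_eq_zero_of_skew_inner {A : F →ₗ[ℝ] F} (hA : ∀ u v, ⟪A u, v⟫_ℝ = -⟪u, A v⟫_ℝ) :
    LinearMap.trace ℝ F A = 0 := by
  rw [LinearMap.trace_eq_sum_inner A (stdOrthonormalBasis ℝ F)]
  refine Finset.sum_eq_zero fun i _ => ?_
  have h := hA (stdOrthonormalBasis ℝ F i) (stdOrthonormalBasis ℝ F i)
  rw [real_inner_comm] at h
  linarith

theorem norm_sq_apply_le_of_skew_inner {A : F →ₗ[ℝ] F}
    (hA : ∀ u v, ⟪A u, v⟫_ℝ = -⟪u, A v⟫_ℝ) (v : F) :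
    ⟪A v, A v⟫_ℝ ≤ -LinearMap.trace ℝ F (A ∘ₗ A) * ⟪v, v⟫_ℝ := by
  set b := stdOrthonormalBasis ℝ F
  have htr : -LinearMap.trace ℝ F (A ∘ₗ A) = ∑ i, ‖A (b i)‖ ^ 2 := by
    rw [LinearMap.trace_eq_sum_inner (A ∘ₗ A) b, ← Finset.sum_neg_distrib]
    refine Finset.sum_congr rfl fun i _ => ?_
    have h := hA (b i) (A (b i))
    rw [LinearMap.comp_apply, ← h, real_inner_self_eq_norm_sq]
  have hAv : ⟪A v, A v⟫_ℝ = ∑ i, ⟪A (b i), v⟫_ℝ ^ 2 := by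
    rw [real_inner_self_eq_norm_sq, ← b.sum_sq_norm_inner_right]
    refine Finset.sum_congr rfl fun i _ => ?_
    rw [hA]
    simp
  rw [htr, hAv, Finset.sum_mul]
  refine Finset.sum_le_sum fun i _ => ?_
  rw [real_inner_self_eq_norm_sq, ← mul_pow]
  exact sq_le_sq' (by linarith [neg_le_of_abs_le (abs_real_inner_le_norm (A (b i)) v)])
    (real_inner_le_norm _ _)

end InnerProduct

section Form

variable {F : Type*} [AddCommGroup F] [Module ℝ F] [FiniteDimensional ℝ F]
  {B : F →ₗ[ℝ] F →ₗ[ℝ] ℝ}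

theorem trace_eq_zero_of_skew (hs : ∀ u v, B u v = B v u) (hp : ∀ v, v ≠ 0 → 0 < B v v)
    {A : F →ₗ[ℝ] F} (hA : ∀ u v, B (A u) v = -B u (A v)) : LinearMap.trace ℝ F A = 0 := by
  let := coreOfForm B hs hp
  let : NormedAddCommGroup F := InnerProductSpace.Core.toNormedAddCommGroup (𝕜 := ℝ)
  let : InnerProductSpace ℝ F := InnerProductSpace.ofCore (coreOfForm B hs hp).toCore
  exact trace_eq_zero_of_skew_inner hA

/-- The operator norm of a skew endomorphism is at most its Hilbert-Schmidt norm. -/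
theorem apply_le_of_skew (hs : ∀ u v, B u v = B v u) (hp : ∀ v, v ≠ 0 → 0 < B v v)
    {A : F →ₗ[ℝ] F} (hA : ∀ u v, B (A u) v = -B u (A v)) (v : F) :
    B (A v) (A v) ≤ -LinearMap.trace ℝ F (A ∘ₗ A) * B v v := by
  let := coreOfForm B hs hp
  let : NormedAddCommGroup F := InnerProductSpace.Core.toNormedAddCommGroup (𝕜 := ℝ)
  let : InnerProductSpace ℝ F := InnerProductSpace.ofCore (coreOfForm B hs hp).toCore
  exact norm_sq_apply_le_of_skew_inner hA v

theorem trace_sq_nonpos_of_skew (hs : ∀ u v, B u v = B v u) (hp : ∀ v, v ≠ 0 → 0 < B v v)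
    {A : F →ₗ[ℝ] F} (hA : ∀ u v, B (A u) v = -B u (A v)) :
    0 ≤ -LinearMap.trace ℝ F (A ∘ₗ A) := by
  have hnn : ∀ v, 0 ≤ B v v := fun v => by
    by_cases h : v = 0
    · simp [h]
    · exact (hp v h).le
  by_cases h : ∃ v : F, v ≠ 0
  · obtain ⟨v, hv⟩ := h
    have := (hnn (A v)).trans (apply_le_of_skew hs hp hA v)
    exact nonneg_of_mul_nonneg_left this (hp v hv)
  · push Not at h
    have : A ∘ₗ A = 0 := LinearMap.ext fun v => by simp [h v]
    simp [this]

/-- The quantitative core of the argument: if the vectors `ξ l` are combinations, with fixed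
coefficients, of the `A j (ξ i) - A i (ξ j)` with skew `A i`, then the `A i` cannot all be small.
The bound is scale invariant: it depends neither on the form `B` nor on the `ξ i`. -/
theorem exists_pos_le_sum_trace {ι : Type*} [Fintype ι] (a : ι → ι → ι → ℝ) :
    ∃ c : ℝ, 0 < c ∧ ∀ {F : Type*} [AddCommGroup F] [Module ℝ F] [FiniteDimensional ℝ F]
      (B : F →ₗ[ℝ] F →ₗ[ℝ] ℝ), (∀ u v, B u v = B v u) → (∀ v, v ≠ 0 → 0 < B v v) →
      ∀ (ξ : ι → F) (A : ι → F →ₗ[ℝ] F), (∀ i u v, B (A i u) v = -B u (A i v)) →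
      (∀ l, ξ l = ∑ i, ∑ j, a l i j • (A j (ξ i) - A i (ξ j))) → (∃ i, ξ i ≠ 0) →
      c ≤ ∑ i, -LinearMap.trace ℝ F (A i ∘ₗ A i) := by
  -- with `ξ l` of maximal length, each `A j (ξ i)` has length at most `√q * ‖ξ l‖`, where `q` is
  -- the sum to be bounded; the relation for `ξ l` then gives `1 ≤ 2 * S * √q`
  set S : ℝ := (∑ l, ∑ i, ∑ j, |a l i j|) + 1 with hS
  have hS0 : 0 < S := by positivity
  refine ⟨1 / (4 * S ^ 2), by positivity, ?_⟩
  intro F _ _ _ B hs hp ξ A hA hξ hne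
  let := coreOfForm B hs hp
  let : NormedAddCommGroup F := InnerProductSpace.Core.toNormedAddCommGroup (𝕜 := ℝ)
  let : InnerProductSpace ℝ F := InnerProductSpace.ofCore (coreOfForm B hs hp).toCore
  set q := ∑ i, -LinearMap.trace ℝ F (A i ∘ₗ A i) with hq
  have hq0 : ∀ i, 0 ≤ -LinearMap.trace ℝ F (A i ∘ₗ A i) :=
    fun i => trace_sq_nonpos_of_skew hs hp (hA i)
  obtain ⟨i₀, hi₀⟩ := hne
  obtain ⟨l, -, hl⟩ := Finset.exists_max_image Finset.univ (fun i => ‖ξ i‖) ⟨i₀, Finset.mem_univ _⟩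
  have hm : 0 < ‖ξ l‖ := (norm_pos_iff.mpr hi₀).trans_le (hl i₀ (Finset.mem_univ _))
  have hAn : ∀ i j, ‖A i (ξ j)‖ ≤ √q * ‖ξ l‖ := by
    intro i j
    have h1 : ‖A i (ξ j)‖ ^ 2 ≤ q * ‖ξ l‖ ^ 2 := by
      calc ‖A i (ξ j)‖ ^ 2 ≤ -LinearMap.trace ℝ F (A i ∘ₗ A i) * ‖ξ j‖ ^ 2 := by
            rw [← real_inner_self_eq_norm_sq, ← real_inner_self_eq_norm_sq]
            exact norm_sq_apply_le_of_skew_inner (hA i) (ξ j)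
        _ ≤ q * ‖ξ l‖ ^ 2 := by
            have := Finset.single_le_sum (fun i _ => hq0 i) (Finset.mem_univ i)
            have h3 := hl j (Finset.mem_univ j)
            gcongr
            exact (hq0 i).trans this
    rw [← Real.sqrt_sq (norm_nonneg (A i (ξ j)))]
    calc √(‖A i (ξ j)‖ ^ 2) ≤ √(q * ‖ξ l‖ ^ 2) := Real.sqrt_le_sqrt h1
      _ = √q * ‖ξ l‖ := by
        rw [Real.sqrt_mul (Finset.sum_nonneg fun i _ => hq0 i), Real.sqrt_sq (norm_nonneg _)]
  have h2 : ‖ξ l‖ ≤ S * (2 * (√q * ‖ξ l‖)) := by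
    calc ‖ξ l‖ = ‖∑ i, ∑ j, a l i j • (A j (ξ i) - A i (ξ j))‖ := by rw [← hξ l]
      _ ≤ ∑ i, ∑ j, |a l i j| * (2 * (√q * ‖ξ l‖)) := by
        refine (norm_sum_le _ _).trans (Finset.sum_le_sum fun i _ => (norm_sum_le _ _).trans
          (Finset.sum_le_sum fun j _ => ?_))
        rw [norm_smul, Real.norm_eq_abs]
        have := norm_sub_le (A j (ξ i)) (A i (ξ j))
        have h3 := hAn i j
        have h4 := hAn j i
        gcongr
        linarith
      _ ≤ S * (2 * (√q * ‖ξ l‖)) := by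
        simp_rw [← Finset.sum_mul]
        gcongr
        have := Finset.single_le_sum (f := fun l => ∑ i, ∑ j, |a l i j|)
          (fun i _ => by positivity) (Finset.mem_univ l)
        rw [hS]
        exact this.trans (by simp)
  have h3 : 1 ≤ 2 * S * √q := by
    refine le_of_mul_le_mul_right ?_ hm
    linarith
  have h4 : 1 ≤ (2 * S * √q) ^ 2 := one_le_pow₀ h3
  rw [mul_pow, Real.sq_sqrt (Finset.sum_nonneg fun i _ => hq0 i)] at h4
  rw [div_le_iff₀ (by positivity)]
  linarith

end Form

/-- In a non-abelian finite-dimensional real Lie algebra with an `ad`-invariant inner product, the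
negative of the Killing form is an inner product on the derived algebra. An orthonormal basis of
it consists of combinations of its own brackets, and sums of a bilinear form over it do not change
under automorphisms. -/
theorem exists_invariant_family {k : Type*} [LieRing k] [LieAlgebra ℝ k] [FiniteDimensional ℝ k]
    (Q : k →ₗ[ℝ] k →ₗ[ℝ] ℝ) (hs : ∀ x y, Q x y = Q y x) (hp : ∀ x, x ≠ 0 → 0 < Q x x)
    (hinv : ∀ x y z : k, Q ⁅x, y⁆ z = -Q y ⁅x, z⁆) (hna : ∃ x y : k, ⁅x, y⁆ ≠ 0) :
    ∃ (n : ℕ) (X : Fin n → k) (a : Fin n → Fin n → Fin n → ℝ),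
      (∀ l, X l = ∑ i, ∑ j, a l i j • ⁅X i, X j⁆) ∧ (∃ i, X i ≠ 0) ∧
      ∀ (e : k ≃ₗ⁅ℝ⁆ k) (β : k →ₗ[ℝ] k →ₗ[ℝ] ℝ),
        ∑ i, β (e (X i)) (e (X i)) = ∑ i, β (X i) (X i) := by
  set D : Submodule ℝ k := Submodule.span ℝ {z | ∃ x y : k, ⁅x, y⁆ = z} with hD
  have hmemD : ∀ x y : k, ⁅x, y⁆ ∈ D := fun x y => Submodule.subset_span ⟨x, y, rfl⟩
  have hDle : ∀ S : Submodule ℝ k, (∀ x y : k, ⁅x, y⁆ ∈ S) → D ≤ S := by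
    intro S hS
    rw [hD, Submodule.span_le]
    rintro _ ⟨y, z, rfl⟩
    exact hS y z
  have hQ0 : ∀ x, Q x x = 0 → x = 0 := fun x h => by
    by_contra hx
    exact (hp x hx).ne' h
  -- the orthogonal complement of the derived algebra is central
  have hdec : ∀ x : k, ∃ d ∈ D, ∀ y : k, ⁅x, y⁆ = ⁅d, y⁆ := by
    let := coreOfForm Q hs hp
    let : NormedAddCommGroup k := InnerProductSpace.Core.toNormedAddCommGroup (𝕜 := ℝ)
    let : InnerProductSpace ℝ k := InnerProductSpace.ofCore (coreOfForm Q hs hp).toCore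
    intro x
    obtain ⟨d, hd, d', hd', hx⟩ := D.exists_add_mem_mem_orthogonal x
    refine ⟨d, hd, fun y => ?_⟩
    have h0 : ⁅d', y⁆ = 0 := by
      apply hQ0
      have h1 : Q ⁅y, ⁅d', y⁆⁆ d' = 0 := (Submodule.mem_orthogonal D d').1 hd' _ (hmemD _ _)
      rwa [hinv, ← lie_skew y d', map_neg, neg_neg] at h1
    rw [hx, add_lie, h0, add_zero]
  -- the Killing form is negative definite on the derived algebra
  have hadskew : ∀ x u v : k, Q (LieAlgebra.ad ℝ k x u) v = -Q u (LieAlgebra.ad ℝ k x v) :=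
    fun x u v => hinv x u v
  have hBpos : ∀ x ∈ D, x ≠ 0 → 0 < -killingForm ℝ k x x := by
    intro x hxD hx
    rw [killingForm_apply_apply]
    refine lt_of_le_of_ne (trace_sq_nonpos_of_skew hs hp (hadskew x)) fun h0 => hx ?_
    have hc : ∀ y : k, ⁅x, y⁆ = 0 := by
      intro y
      apply hQ0
      have h1 := apply_le_of_skew hs hp (hadskew x) y
      rw [← h0, zero_mul] at h1
      by_contra h2
      exact (hp ⁅x, y⁆ fun h => h2 (by simp [h])).not_ge h1
    apply hQ0
    refine hDle (LinearMap.ker (Q x)) (fun y z => ?_) hxD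
    rw [LinearMap.mem_ker, hs, hinv, ← lie_skew, hc]
    simp
  set B : D →ₗ[ℝ] D →ₗ[ℝ] ℝ := (-killingForm ℝ k).domRestrict₁₂ D D with hB
  have hBapp : ∀ x y : D, B x y = -killingForm ℝ k x y := fun x y => rfl
  have hBs : ∀ x y : D, B x y = B y x := fun x y => by
    rw [hBapp, hBapp, LieModule.traceForm_comm]
  have hBp : ∀ x : D, x ≠ 0 → 0 < B x x := fun x hx =>
    hBpos x x.2 (by simpa using hx)
  let := coreOfForm B hBs hBp
  let : NormedAddCommGroup D := InnerProductSpace.Core.toNormedAddCommGroup (𝕜 := ℝ)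
  let : InnerProductSpace ℝ D := InnerProductSpace.ofCore (coreOfForm B hBs hBp).toCore
  set b := stdOrthonormalBasis ℝ D with hb
  -- by `hdec`, every bracket is a bracket of elements of the derived algebra
  have hspan : ∀ x y : k, ⁅x, y⁆ ∈ Submodule.span ℝ
      (Set.range fun p : Fin (Module.finrank ℝ D) × Fin (Module.finrank ℝ D) =>
        ⁅(b p.1 : k), (b p.2 : k)⁆) := by
    intro x y
    obtain ⟨d, hd, hd'⟩ := hdec x
    obtain ⟨f, hf, hf'⟩ := hdec y
    have h1 : ⁅x, y⁆ = ⁅d, f⁆ := by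
      rw [hd', ← lie_skew, hf', lie_skew]
    have h2 : d = ∑ i, b.repr ⟨d, hd⟩ i • (b i : k) := by
      have := congrArg (Subtype.val) (b.sum_repr ⟨d, hd⟩)
      simpa using this.symm
    have h3 : f = ∑ i, b.repr ⟨f, hf⟩ i • (b i : k) := by
      have := congrArg (Subtype.val) (b.sum_repr ⟨f, hf⟩)
      simpa using this.symm
    rw [h1, h2, h3]
    simp only [sum_lie, lie_sum, smul_lie, lie_smul]
    exact Submodule.sum_mem _ fun i _ => Submodule.smul_mem _ _ <| Submodule.sum_mem _ fun j _ =>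
      Submodule.smul_mem _ _ (Submodule.subset_span ⟨(j, i), rfl⟩)
  have hcoef : ∀ l, ∃ c : Fin (Module.finrank ℝ D) × Fin (Module.finrank ℝ D) → ℝ,
      ∑ p, c p • ⁅(b p.1 : k), (b p.2 : k)⁆ = b l :=
    fun l => (Submodule.mem_span_range_iff_exists_fun ℝ).1 (hDle _ hspan (b l).2)
  choose c hc using hcoef
  refine ⟨Module.finrank ℝ D, fun i => b i, fun l i j => c l (i, j), fun l => ?_, ?_, ?_⟩
  · simp only [← hc l, Fintype.sum_prod_type]
  · -- the brackets of the basis span the derived algebra, which is not zero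
    by_contra! h0
    obtain ⟨x, y, hxy⟩ := hna
    apply hxy
    have h1 := hspan x y
    simp only [h0, lie_zero] at h1
    have h2 := Submodule.span_le.2 (show Set.range (fun _ : Fin (Module.finrank ℝ D) ×
      Fin (Module.finrank ℝ D) => (0 : k)) ⊆ (⊥ : Submodule ℝ k) by
        rintro _ ⟨_, rfl⟩
        simp) h1
    simpa using h2
  · -- automorphisms preserve the derived algebra and the Killing form
    intro e β
    have heD : ∀ x ∈ D, e x ∈ D := by
      intro x hx
      refine hDle (D.comap (e : k →ₗ[ℝ] k)) (fun y z => ?_) hx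
      have : e ⁅y, z⁆ ∈ D := by
        rw [LieEquiv.map_lie]
        exact hmemD _ _
      simpa using this
    set eD : D →ₗ[ℝ] D := (e : k →ₗ[ℝ] k).restrict heD with heDdef
    have heDapp : ∀ x : D, (eD x : k) = e x := fun x => rfl
    have hiso : ∀ x y : D, ⟪eD x, eD y⟫_ℝ = ⟪x, y⟫_ℝ := by
      intro x y
      change B (eD x) (eD y) = B x y
      rw [hBapp, hBapp, heDapp, heDapp, LieAlgebra.killingForm_of_equiv_apply]
    let eI : D →ₗᵢ[ℝ] D := eD.isometryOfInner hiso
    let eE : D ≃ₗᵢ[ℝ] D := eI.toLinearIsometryEquiv rfl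
    exact sum_apply_self_orthonormalBasis b (b.map eE) (β.domRestrict₁₂ D D)

end LinearAlgebra

/-! ### The Bochner-Yano identity for Killing fields in coordinates -/

section Bochner

open scoped Topology

variable {E : Type*} [NormedAddCommGroup E] [NormedSpace ℝ E]

/-- The Christoffel symbols of a metric in coordinates as a bundled bilinear map. -/
noncomputable def christoffelL (G : E → E →L[ℝ] E →L[ℝ] ℝ) (y : E) : E →L[ℝ] E →L[ℝ] E :=
  (ContinuousLinearMap.compL ℝ E (E →L[ℝ] ℝ) E (G y).inverse).comp
    ((1 / 2 : ℝ) • (fderiv ℝ G y + (fderiv ℝ G y).flip -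
      (ContinuousLinearMap.flipₗᵢ ℝ E E ℝ : (E →L[ℝ] E →L[ℝ] ℝ) →L[ℝ] (E →L[ℝ] E →L[ℝ] ℝ)).comp
        (fderiv ℝ G y).flip))

theorem christoffelL_apply (G : E → E →L[ℝ] E →L[ℝ] ℝ) (y u v : E) :
    christoffelL G y u v = christoffel G y u v := by
  simp [christoffelL, christoffel, christoffelFirst]

/-- The covariant derivative `u ↦ ∇_u ξ` of a vector field, for Christoffel symbols `Γ`. -/
noncomputable def covDeriv (Γ : E → E →L[ℝ] E →L[ℝ] E) (ξ : E → E) (y : E) : E →L[ℝ] E :=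
  fderiv ℝ ξ y + (Γ y).flip (ξ y)

theorem covDeriv_apply (Γ : E → E →L[ℝ] E →L[ℝ] E) (ξ : E → E) (y u : E) :
    covDeriv Γ ξ y u = fderiv ℝ ξ y u + Γ y u (ξ y) := by
  simp [covDeriv]

section Yano

variable {Γ : E → E →L[ℝ] E →L[ℝ] E} {ξ : E → E} {y : E}

theorem differentiableAt_covDeriv (hΓ : ContDiffAt ℝ ∞ Γ y) (hξ : ContDiffAt ℝ ∞ ξ y) :
    DifferentiableAt ℝ (covDeriv Γ ξ) y := by
  have h1 : DifferentiableAt ℝ (fderiv ℝ ξ) y :=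
    (hξ.fderiv_right (m := ∞) (by simp)).differentiableAt (by simp)
  have h2 : DifferentiableAt ℝ (fun z => (Γ z).flip) y :=
    ((ContinuousLinearMap.flipₗᵢ ℝ E E E).contDiff.contDiffAt.comp y hΓ).differentiableAt (by simp)
  exact h1.add (h2.clm_apply (hξ.differentiableAt (by simp)))

theorem fderiv_covDeriv_apply (hΓ : ContDiffAt ℝ ∞ Γ y) (hξ : ContDiffAt ℝ ∞ ξ y) (u v : E) :
    fderiv ℝ (covDeriv Γ ξ) y u v =
      fderiv ℝ (fderiv ℝ ξ) y u v + fderiv ℝ Γ y u v (ξ y) + Γ y v (fderiv ℝ ξ y u) := by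
  have h1 : HasFDerivAt (fderiv ℝ ξ) (fderiv ℝ (fderiv ℝ ξ) y) y :=
    ((hξ.fderiv_right (m := ∞) (by simp)).differentiableAt (by simp)).hasFDerivAt
  have hξ1 : HasFDerivAt ξ (fderiv ℝ ξ y) y := (hξ.differentiableAt (by simp)).hasFDerivAt
  have hΓ1 : HasFDerivAt Γ (fderiv ℝ Γ y) y := (hΓ.differentiableAt (by simp)).hasFDerivAt
  have h2 := (h1.clm_apply (hasFDerivAt_const v y)).add
    ((hΓ1.clm_apply (hasFDerivAt_const v y)).clm_apply hξ1)
  have h3 := ((differentiableAt_covDeriv hΓ hξ).hasFDerivAt.clm_apply (hasFDerivAt_const v y))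
  have h4 : (fun z => covDeriv Γ ξ z v) = fun z => fderiv ℝ ξ z v + Γ z v (ξ z) :=
    funext fun z => covDeriv_apply Γ ξ z v
  rw [h4] at h3
  have h5 := congrArg (fun L : E →L[ℝ] E => L u) (h3.unique h2)
  simp only [add_apply, ContinuousLinearMap.comp_apply,
    ContinuousLinearMap.flip_apply, zero_apply, map_zero, zero_add] at h5
  rw [h5]
  abel

/-- Yano's identity before taking traces: for a torsion-free connection,
`R(u, ξ) ξ = ∇_u (∇_ξ ξ) - (∇_ξ ∇ξ) u - ∇ξ (∇ξ u)`. The last two terms of the formula form a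
commutator: they turn the coordinate derivative of `∇ξ` into the covariant one. -/
theorem curvature_self_eq (hΓ : ContDiffAt ℝ ∞ Γ y) (hξ : ContDiffAt ℝ ∞ ξ y)
    (hs : ∀ u v, Γ y u v = Γ y v u) (u : E) :
    fderiv ℝ Γ y u (ξ y) (ξ y) - fderiv ℝ Γ y (ξ y) u (ξ y) + Γ y u (Γ y (ξ y) (ξ y))
        - Γ y (ξ y) (Γ y u (ξ y)) =
      (fderiv ℝ (fun z => covDeriv Γ ξ z (ξ z)) y + (Γ y).flip (covDeriv Γ ξ y (ξ y))
        - fderiv ℝ (covDeriv Γ ξ) y (ξ y) - covDeriv Γ ξ y ∘L covDeriv Γ ξ y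
        + (fderiv ℝ ξ y ∘L (Γ y).flip (ξ y) - (Γ y).flip (ξ y) ∘L fderiv ℝ ξ y)) u := by
  have hξ1 : HasFDerivAt ξ (fderiv ℝ ξ y) y := (hξ.differentiableAt (by simp)).hasFDerivAt
  have hV := ((differentiableAt_covDeriv hΓ hξ).hasFDerivAt.clm_apply hξ1).fderiv
  have hsymm : fderiv ℝ (fderiv ℝ ξ) y u (ξ y) = fderiv ℝ (fderiv ℝ ξ) y (ξ y) u :=
    (hξ.isSymmSndFDerivAt (by simp; exact ENat.LEInfty.out)) u (ξ y)
  rw [hV]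
  simp only [add_apply, sub_apply,
    ContinuousLinearMap.comp_apply, ContinuousLinearMap.flip_apply, fderiv_covDeriv_apply hΓ hξ,
    covDeriv_apply, map_add, hsymm]
  rw [hs (fderiv ℝ ξ y u) (ξ y), hs (Γ y u (ξ y)) (ξ y)]
  abel

end Yano

section Killing

variable {G : E → E →L[ℝ] E →L[ℝ] ℝ} {U : Set E}

theorem fderiv_metric_symm (hU : IsOpen U) (hs : ∀ y ∈ U, ∀ u v, G y u v = G y v u)
    (hG : ContDiffOn ℝ ∞ G U) {y : E} (hy : y ∈ U) (w u v : E) :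
    fderiv ℝ G y w u v = fderiv ℝ G y w v u := by
  have hd : DifferentiableAt ℝ G y :=
    (hG.contDiffAt (hU.mem_nhds hy)).differentiableAt (by simp)
  have key : ∀ a b : E, fderiv ℝ (fun z => G z a b) y w = fderiv ℝ G y w a b := by
    intro a b
    have := ((hd.hasFDerivAt.clm_apply (hasFDerivAt_const a y)).clm_apply
      (hasFDerivAt_const b y)).fderiv
    rw [this]
    simp
  rw [← key, ← key]
  congr 1
  apply Filter.EventuallyEq.fderiv_eq
  filter_upwards [hU.mem_nhds hy] with z hz using hs z hz u v

theorem christoffelL_symm (hU : IsOpen U) (hs : ∀ y ∈ U, ∀ u v, G y u v = G y v u)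
    (hG : ContDiffOn ℝ ∞ G U) {y : E} (hy : y ∈ U) (u v : E) :
    christoffelL G y u v = christoffelL G y v u := by
  rw [christoffelL_apply, christoffelL_apply, christoffel, christoffel]
  congr 1
  ext w
  rw [christoffelFirst_apply, christoffelFirst_apply, fderiv_metric_symm hU hs hG hy w u v]
  ring

variable [FiniteDimensional ℝ E]

theorem isInvertible_of_posDef {B : E →L[ℝ] E →L[ℝ] ℝ} (hB : ∀ v, v ≠ 0 → 0 < B v v) :
    B.IsInvertible := by
  have hinj : Function.Injective (B : E →ₗ[ℝ] E →L[ℝ] ℝ) := by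
    rw [← LinearMap.ker_eq_bot, LinearMap.ker_eq_bot']
    intro v hv
    by_contra h
    have h1 := hB v h
    have h2 : B v = 0 := hv
    simp [h2] at h1
  have hdim : Module.finrank ℝ E = Module.finrank ℝ (E →L[ℝ] ℝ) := by
    rw [← (LinearMap.toContinuousLinearMap (𝕜 := ℝ) (E := E) (F' := ℝ)).finrank_eq]
    exact (Subspace.dual_finrank_eq (K := ℝ) (V := E)).symm
  let e := LinearEquiv.ofInjectiveOfFinrankEq (B : E →ₗ[ℝ] E →L[ℝ] ℝ) hinj hdim
  exact ⟨e.toContinuousLinearEquiv, by ext; rfl⟩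

theorem contDiffAt_christoffelL {G : E → E →L[ℝ] E →L[ℝ] ℝ} {y : E} (hG : ContDiffAt ℝ ∞ G y)
    (hi : (G y).IsInvertible) : ContDiffAt ℝ ∞ (christoffelL G) y := by
  have hD : ContDiffAt ℝ ∞ (fderiv ℝ G) y := hG.fderiv_right (by simp)
  have hDf : ContDiffAt ℝ ∞ (fun z => (fderiv ℝ G z).flip) y :=
    (ContinuousLinearMap.flipₗᵢ ℝ E E (E →L[ℝ] ℝ)).contDiff.contDiffAt.comp y hD
  have hinv : ContDiffAt ℝ ∞ (fun z => (G z).inverse) y := by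
    obtain ⟨e, he⟩ := hi
    have : CompleteSpace E := FiniteDimensional.complete ℝ E
    have h1 := contDiffAt_map_inverse (n := ∞) e
    rw [he] at h1
    exact h1.comp y hG
  have h1 : ContDiffAt ℝ ∞
      (fun z => ContinuousLinearMap.compL ℝ E (E →L[ℝ] ℝ) E (G z).inverse) y :=
    (ContinuousLinearMap.compL ℝ E (E →L[ℝ] ℝ) E).contDiff.contDiffAt.comp y hinv
  exact h1.clm_comp
    (ContDiffAt.const_smul (1 / 2 : ℝ) ((hD.add hDf).sub (contDiffAt_const.clm_comp hDf)))

/-- The Ricci curvature as the trace of an endomorphism which agrees with the curvature. -/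
theorem coordRicci_eq_trace {G : E → E →L[ℝ] E →L[ℝ] ℝ} {y v w : E} {T : E →ₗ[ℝ] E}
    (hT : ∀ u, curvature G y u v w = T u) : coordRicci G y v w = LinearMap.trace ℝ E T := by
  rw [LinearMap.trace_eq_matrix_trace ℝ (Module.finBasis ℝ E), Matrix.trace]
  simp [coordRicci, hT, LinearMap.toMatrix_apply]

/-- The covariant derivative of a Killing field is skew. -/
theorem metric_covDeriv_skew (hU : IsOpen U) (hs : ∀ y ∈ U, ∀ u v, G y u v = G y v u)
    (hp : ∀ y ∈ U, ∀ v, v ≠ 0 → 0 < G y v v) (hG : ContDiffOn ℝ ∞ G U) {ξ : E → E} {y : E}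
    (hy : y ∈ U) (hK : ∀ v w, fderiv ℝ G y (ξ y) v w + G y (fderiv ℝ ξ y v) w
      + G y v (fderiv ℝ ξ y w) = 0) (u v : E) :
    G y (covDeriv (christoffelL G) ξ y u) v = -G y u (covDeriv (christoffelL G) ξ y v) := by
  have hi := isInvertible_of_posDef (hp y hy)
  have h1 := metric_christoffel G y hi u (ξ y) v
  have h2 := metric_christoffel G y hi v (ξ y) u
  have h3 := hK u v
  rw [covDeriv_apply, covDeriv_apply, christoffelL_apply, christoffelL_apply, map_add, map_add,
    add_apply, h1, hs y hy u (christoffel G y v (ξ y)), h2,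
    fderiv_metric_symm hU hs hG hy v (ξ y) u, fderiv_metric_symm hU hs hG hy u (ξ y) v,
    fderiv_metric_symm hU hs hG hy (ξ y) v u]
  linarith

/-- If Killing fields `ξ i` have constant `∑ |ξ i|²`, then `∑ ∇_{ξ i} ξ i = 0`: this sum is
half the negative gradient of `∑ |ξ i|²`. -/
theorem sum_covDeriv_self_eq_zero {ι : Type*} [Fintype ι] (hU : IsOpen U)
    (hs : ∀ y ∈ U, ∀ u v, G y u v = G y v u)
    (hp : ∀ y ∈ U, ∀ v, v ≠ 0 → 0 < G y v v) (hG : ContDiffOn ℝ ∞ G U) {ξ : ι → E → E}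
    (hξ : ∀ i, ContDiffOn ℝ ∞ (ξ i) U)
    (hK : ∀ i, ∀ y ∈ U, ∀ v w, fderiv ℝ G y (ξ i y) v w + G y (fderiv ℝ (ξ i) y v) w
      + G y v (fderiv ℝ (ξ i) y w) = 0)
    {C : ℝ} (hC : ∀ y ∈ U, ∑ i, G y (ξ i y) (ξ i y) = C) {y : E} (hy : y ∈ U) :
    ∑ i, covDeriv (christoffelL G) (ξ i) y (ξ i y) = 0 := by
  have hi := isInvertible_of_posDef (hp y hy)
  have hGd : HasFDerivAt G (fderiv ℝ G y) y :=
    ((hG.contDiffAt (hU.mem_nhds hy)).differentiableAt (by simp)).hasFDerivAt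
  have hξd : ∀ i, HasFDerivAt (ξ i) (fderiv ℝ (ξ i) y) y := fun i =>
    (((hξ i).contDiffAt (hU.mem_nhds hy)).differentiableAt (by simp)).hasFDerivAt
  have hgrad : ∀ w, ∑ i, (fderiv ℝ G y w (ξ i y) (ξ i y)
      + 2 * G y (fderiv ℝ (ξ i) y w) (ξ i y)) = 0 := by
    intro w
    have h1 := HasFDerivAt.fun_sum (u := Finset.univ)
      fun i _ => ((hGd.clm_apply (hξd i)).clm_apply (hξd i))
    have h2 : HasFDerivAt (fun z => ∑ i, G z (ξ i z) (ξ i z)) (0 : E →L[ℝ] ℝ) y := by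
      refine (hasFDerivAt_const C y).congr_of_eventuallyEq ?_
      filter_upwards [hU.mem_nhds hy] with z hz using hC z hz
    have h3 := congrArg (fun L : E →L[ℝ] ℝ => L w) (h1.unique h2)
    simp only [sum_apply, add_apply,
      ContinuousLinearMap.comp_apply, ContinuousLinearMap.flip_apply,
      zero_apply] at h3
    rw [← h3]
    refine Finset.sum_congr rfl fun i _ => ?_
    rw [hs y hy (ξ i y)]
    ring
  -- pair the sum `V` with itself: `g(∇_ξ ξ, V) = -g(∇_V ξ, ξ)` is minus half of `V |ξ|²`
  by_contra hne
  have hpos := hp y hy _ hne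
  set V := ∑ i, covDeriv (christoffelL G) (ξ i) y (ξ i y) with hV
  refine hpos.ne' ?_
  have h4 : G y V V = -∑ i, G y (covDeriv (christoffelL G) (ξ i) y V) (ξ i y) := by
    change G y V (∑ i, covDeriv (christoffelL G) (ξ i) y (ξ i y)) = _
    rw [map_sum, ← Finset.sum_neg_distrib]
    refine Finset.sum_congr rfl fun i _ => ?_
    rw [metric_covDeriv_skew hU hs hp hG hy (hK i y hy), neg_neg]
  have h5 : ∀ i, G y (covDeriv (christoffelL G) (ξ i) y V) (ξ i y) = (1 / 2 : ℝ) *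
      (fderiv ℝ G y V (ξ i y) (ξ i y) + 2 * G y (fderiv ℝ (ξ i) y V) (ξ i y)) := by
    intro i
    rw [covDeriv_apply, christoffelL_apply, map_add, add_apply,
      metric_christoffel G y hi]
    ring
  rw [h4, Finset.sum_congr rfl fun i _ => h5 i, ← Finset.mul_sum, hgrad]
  simp

/-- The Bochner formula, summed over Killing fields `ξ i` with constant `∑ |ξ i|²`:
`∑ ric(ξ i, ξ i) = ∑ |∇ ξ i|²`. -/
theorem sum_coordRicci_eq {ι : Type*} [Fintype ι] (hU : IsOpen U)
    (hs : ∀ y ∈ U, ∀ u v, G y u v = G y v u)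
    (hp : ∀ y ∈ U, ∀ v, v ≠ 0 → 0 < G y v v) (hG : ContDiffOn ℝ ∞ G U) {ξ : ι → E → E}
    (hξ : ∀ i, ContDiffOn ℝ ∞ (ξ i) U)
    (hK : ∀ i, ∀ y ∈ U, ∀ v w, fderiv ℝ G y (ξ i y) v w + G y (fderiv ℝ (ξ i) y v) w
      + G y v (fderiv ℝ (ξ i) y w) = 0)
    {C : ℝ} (hC : ∀ y ∈ U, ∑ i, G y (ξ i y) (ξ i y) = C) {y : E} (hy : y ∈ U) :
    ∑ i, coordRicci G y (ξ i y) (ξ i y) =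
      ∑ i, -LinearMap.trace ℝ E ((covDeriv (christoffelL G) (ξ i) y : E →ₗ[ℝ] E) ∘ₗ
        (covDeriv (christoffelL G) (ξ i) y : E →ₗ[ℝ] E)) := by
  set Γ := christoffelL G with hΓdef
  have hΓ : ContDiffAt ℝ ∞ Γ y :=
    contDiffAt_christoffelL (hG.contDiffAt (hU.mem_nhds hy)) (isInvertible_of_posDef (hp y hy))
  have hξa : ∀ i, ContDiffAt ℝ ∞ (ξ i) y := fun i => (hξ i).contDiffAt (hU.mem_nhds hy)
  have hsym := christoffelL_symm hU hs hG hy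
  have hcurv : ∀ u v w, curvature G y u v w =
      fderiv ℝ Γ y u v w - fderiv ℝ Γ y v u w + Γ y u (Γ y v w) - Γ y v (Γ y u w) := by
    intro u v w
    have hΓd := (hΓ.differentiableAt (by simp)).hasFDerivAt
    have key : ∀ a b : E, fderiv ℝ (fun z => christoffel G z a b) y =
        ((fderiv ℝ Γ y).flip a).flip b := by
      intro a b
      simp_rw [← christoffelL_apply]
      rw [((hΓd.clm_apply (hasFDerivAt_const a y)).clm_apply (hasFDerivAt_const b y)).fderiv]
      ext c
      simp
    simp only [curvature, key, ContinuousLinearMap.flip_apply, hΓdef, christoffelL_apply]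
  -- skew endomorphisms are trace-free at all points, hence so are their derivatives
  have htrace : ∀ i, LinearMap.trace ℝ E (fderiv ℝ (covDeriv Γ (ξ i)) y (ξ i y) : E →ₗ[ℝ] E)
      = 0 := by
    intro i
    let tr : (E →L[ℝ] E) →L[ℝ] ℝ := LinearMap.toContinuousLinearMap
      ((LinearMap.trace ℝ E).comp (ContinuousLinearMap.coeLM ℝ))
    have h1 := (tr.hasFDerivAt.comp y (differentiableAt_covDeriv hΓ (hξa i)).hasFDerivAt)
    have h2 : HasFDerivAt (tr ∘ covDeriv Γ (ξ i)) (0 : E →L[ℝ] ℝ) y := by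
      refine (hasFDerivAt_const (0 : ℝ) y).congr_of_eventuallyEq ?_
      filter_upwards [hU.mem_nhds hy] with z hz
      exact trace_eq_zero_of_skew (B := (G z).toLinearMap₁₂) (hs z hz) (hp z hz)
        (metric_covDeriv_skew hU hs hp hG hz (hK i z hz))
    have h3 := congrArg (fun L : E →L[ℝ] ℝ => L (ξ i y)) (h1.unique h2)
    exact h3
  have hVd : ∀ i, DifferentiableAt ℝ (fun z => covDeriv Γ (ξ i) z (ξ i z)) y := fun i =>
    (differentiableAt_covDeriv hΓ (hξa i)).clm_apply ((hξa i).differentiableAt (by simp))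
  have hV0 : ∑ i, covDeriv Γ (ξ i) y (ξ i y) = 0 :=
    sum_covDeriv_self_eq_zero hU hs hp hG hξ hK hC hy
  have hV1 : ∑ i, fderiv ℝ (fun z => covDeriv Γ (ξ i) z (ξ i z)) y = 0 := by
    rw [← fderiv_fun_sum fun i _ => hVd i]
    have : (fun z => ∑ i, covDeriv Γ (ξ i) z (ξ i z)) =ᶠ[𝓝 y] fun _ => (0 : E) := by
      filter_upwards [hU.mem_nhds hy] with z hz
      exact sum_covDeriv_self_eq_zero hU hs hp hG hξ hK hC hz
    rw [this.fderiv_eq]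
    simp
  have hric : ∀ i, coordRicci G y (ξ i y) (ξ i y) =
      LinearMap.trace ℝ E (fderiv ℝ (fun z => covDeriv Γ (ξ i) z (ξ i z)) y : E →ₗ[ℝ] E)
      + LinearMap.trace ℝ E ((Γ y).flip (covDeriv Γ (ξ i) y (ξ i y)) : E →ₗ[ℝ] E)
      + -LinearMap.trace ℝ E ((covDeriv Γ (ξ i) y : E →ₗ[ℝ] E) ∘ₗ
        (covDeriv Γ (ξ i) y : E →ₗ[ℝ] E)) := by
    intro i
    rw [coordRicci_eq_trace (T := ((fderiv ℝ (fun z => covDeriv Γ (ξ i) z (ξ i z)) y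
        + (Γ y).flip (covDeriv Γ (ξ i) y (ξ i y))
        - fderiv ℝ (covDeriv Γ (ξ i)) y (ξ i y) - covDeriv Γ (ξ i) y ∘L covDeriv Γ (ξ i) y
        + (fderiv ℝ (ξ i) y ∘L (Γ y).flip (ξ i y) - (Γ y).flip (ξ i y) ∘L fderiv ℝ (ξ i) y) :
        E →L[ℝ] E) : E →ₗ[ℝ] E))]
    · have hcomm := LinearMap.trace_comp_comm' ((fderiv ℝ (ξ i) y : E →L[ℝ] E) : E →ₗ[ℝ] E)
        ((Γ y).flip (ξ i y) : E →ₗ[ℝ] E)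
      simp only [ContinuousLinearMap.toLinearMap_add, ContinuousLinearMap.toLinearMap_sub,
        ContinuousLinearMap.toLinearMap_comp, map_add, map_sub, htrace, hcomm]
      ring
    · intro u
      rw [hcurv, curvature_self_eq hΓ (hξa i) hsym]
      rfl
  have hz1 : ∑ i, LinearMap.trace ℝ E
      (fderiv ℝ (fun z => covDeriv Γ (ξ i) z (ξ i z)) y : E →ₗ[ℝ] E) = 0 := by
    rw [← map_sum, ← ContinuousLinearMap.toLinearMap_sum, hV1]
    simp
  have hz2 : ∑ i, LinearMap.trace ℝ E
      ((Γ y).flip (covDeriv Γ (ξ i) y (ξ i y)) : E →ₗ[ℝ] E) = 0 := by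
    rw [← map_sum, ← ContinuousLinearMap.toLinearMap_sum, ← map_sum, hV0]
    simp
  rw [Finset.sum_congr rfl fun i _ => hric i, Finset.sum_add_distrib, Finset.sum_add_distrib, hz1,
    hz2]
  simp

end Killing

/-- A positive lower bound for `∑ ric(ξ i, ξ i)`, valid for all metrics, as soon as the Killing
fields `ξ i` are combinations of their brackets with fixed coefficients. -/
theorem exists_pos_le_sum_coordRicci {ι : Type*} [Fintype ι] (a : ι → ι → ι → ℝ) :
    ∃ c : ℝ, 0 < c ∧ ∀ {E : Type*} [NormedAddCommGroup E] [NormedSpace ℝ E]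
      [FiniteDimensional ℝ E] {G : E → E →L[ℝ] E →L[ℝ] ℝ} {U : Set E}, IsOpen U →
      (∀ y ∈ U, ∀ u v, G y u v = G y v u) → (∀ y ∈ U, ∀ v, v ≠ 0 → 0 < G y v v) →
      ContDiffOn ℝ ∞ G U → ∀ {ξ : ι → E → E}, (∀ i, ContDiffOn ℝ ∞ (ξ i) U) →
      (∀ i, ∀ y ∈ U, ∀ v w, fderiv ℝ G y (ξ i y) v w + G y (fderiv ℝ (ξ i) y v) w
        + G y v (fderiv ℝ (ξ i) y w) = 0) →
      ∀ {C : ℝ}, (∀ y ∈ U, ∑ i, G y (ξ i y) (ξ i y) = C) → ∀ {y : E}, y ∈ U →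
      (∀ l, ξ l y = ∑ i, ∑ j, a l i j •
        (fderiv ℝ (ξ j) y (ξ i y) - fderiv ℝ (ξ i) y (ξ j y))) → (∃ i, ξ i y ≠ 0) →
      c ≤ ∑ i, coordRicci G y (ξ i y) (ξ i y) := by
  obtain ⟨c, hc, h⟩ := exists_pos_le_sum_trace a
  refine ⟨c, hc, ?_⟩
  intro E _ _ _ G U hU hs hp hG ξ hξ hK C hC y hy hbr hne
  rw [sum_coordRicci_eq hU hs hp hG hξ hK hC hy]
  refine h (G y).toLinearMap₁₂ (hs y hy) (hp y hy) (fun i => ξ i y)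
    (fun i => (covDeriv (christoffelL G) (ξ i) y : E →ₗ[ℝ] E))
    (fun i => metric_covDeriv_skew hU hs hp hG hy (hK i y hy)) (fun l => ?_) hne
  rw [hbr l]
  refine Finset.sum_congr rfl fun i _ => Finset.sum_congr rfl fun j _ => ?_
  simp only [ContinuousLinearMap.coe_coe, covDeriv_apply]
  rw [christoffelL_symm hU hs hG hy (ξ i y) (ξ j y)]
  congr 1
  abel

end Bochner

/-! ### Derivatives of maps between manifolds, read in the model spaces -/

section ModelDerivative

open scoped Topology

variable {A : Type*} [NormedAddCommGroup A] [NormedSpace ℝ A]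
  {B : Type*} [NormedAddCommGroup B] [NormedSpace ℝ B]
  {C : Type*} [NormedAddCommGroup C] [NormedSpace ℝ C]
  {M : Type*} [TopologicalSpace M] [ChartedSpace A M]
  {N : Type*} [TopologicalSpace N] [ChartedSpace B N]
  {P : Type*} [TopologicalSpace P] [ChartedSpace C P]

variable (A B) in
/-- The derivative of a map between manifolds as a map between the model spaces. As its type does
not depend on the base point, equations between base points can be used to rewrite it. -/
noncomputable def mfd (f : M → N) (x : M) : A →L[ℝ] B := mfderiv 𝓘(ℝ, A) 𝓘(ℝ, B) f x

theorem mfd_comp {g : N → P} {f : M → N} {x : M}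
    (hg : MDifferentiableAt 𝓘(ℝ, B) 𝓘(ℝ, C) g (f x))
    (hf : MDifferentiableAt 𝓘(ℝ, A) 𝓘(ℝ, B) f x) :
    mfd A C (fun z => g (f z)) x = (mfd B C g (f x)).comp (mfd A B f x) :=
  mfderiv_comp x hg hf

theorem mfd_comp_apply {g : N → P} {f : M → N} {x : M}
    (hg : MDifferentiableAt 𝓘(ℝ, B) 𝓘(ℝ, C) g (f x))
    (hf : MDifferentiableAt 𝓘(ℝ, A) 𝓘(ℝ, B) f x) (v : A) :
    mfd A C (fun z => g (f z)) x v = mfd B C g (f x) (mfd A B f x v) := by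
  rw [mfd_comp hg hf]
  rfl

theorem mfd_congr {f g : M → N} {x : M} (h : f =ᶠ[𝓝 x] g) : mfd A B f x = mfd A B g x :=
  h.mfderiv_eq

theorem mfd_id (x : M) : mfd A A (fun z : M => z) x = ContinuousLinearMap.id ℝ A :=
  mfderiv_id

theorem mfd_eq_fderiv (f : A → B) (x : A) : mfd A B f x = fderiv ℝ f x :=
  mfderiv_eq_fderiv

section Charts

variable [IsManifold 𝓘(ℝ, A) ∞ M] [IsManifold 𝓘(ℝ, B) ∞ N] [IsManifold 𝓘(ℝ, C) ∞ P]

theorem contMDiffAt_chart {x y : M} (hy : y ∈ (chartAt A x).source) :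
    ContMDiffAt 𝓘(ℝ, A) 𝓘(ℝ, A) ∞ (chartAt A x) y :=
  contMDiffAt_of_mem_maximalAtlas (IsManifold.chart_mem_maximalAtlas x) hy

theorem contMDiffAt_chart_symm {x : M} {u : A} (hu : u ∈ (chartAt A x).target) :
    ContMDiffAt 𝓘(ℝ, A) 𝓘(ℝ, A) ∞ (chartAt A x).symm u :=
  contMDiffAt_symm_of_mem_maximalAtlas (IsManifold.chart_mem_maximalAtlas x) hu

theorem mdifferentiableAt_chart {x y : M} (hy : y ∈ (chartAt A x).source) :
    MDifferentiableAt 𝓘(ℝ, A) 𝓘(ℝ, A) (chartAt A x) y :=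
  (contMDiffAt_chart hy).mdifferentiableAt (by simp)

theorem mdifferentiableAt_chart_symm {x : M} {u : A} (hu : u ∈ (chartAt A x).target) :
    MDifferentiableAt 𝓘(ℝ, A) 𝓘(ℝ, A) (chartAt A x).symm u :=
  (contMDiffAt_chart_symm hu).mdifferentiableAt (by simp)

theorem mfd_chart_comp_symm {x : M} {u : A} (hu : u ∈ (chartAt A x).target) (v : A) :
    mfd A A (chartAt A x) ((chartAt A x).symm u) (mfd A A (chartAt A x).symm u v) = v := by
  rw [← mfd_comp_apply (mdifferentiableAt_chart ((chartAt A x).map_target hu))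
    (mdifferentiableAt_chart_symm hu)]
  have : (fun z => chartAt A x ((chartAt A x).symm z)) =ᶠ[𝓝 u] fun z => z := by
    filter_upwards [(chartAt A x).open_target.mem_nhds hu] with z hz
    exact (chartAt A x).right_inv hz
  rw [mfd_congr this, mfd_id]
  rfl

theorem mfd_chart_symm_comp {x y : M} (hy : y ∈ (chartAt A x).source) (v : A) :
    mfd A A (chartAt A x).symm (chartAt A x y) (mfd A A (chartAt A x) y v) = v := by
  rw [← mfd_comp_apply (mdifferentiableAt_chart_symm ((chartAt A x).map_source hy))
    (mdifferentiableAt_chart hy)]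
  have : (fun z => (chartAt A x).symm (chartAt A x z)) =ᶠ[𝓝 y] fun z => z := by
    filter_upwards [(chartAt A x).open_source.mem_nhds hy] with z hz
    exact (chartAt A x).left_inv hz
  rw [mfd_congr this, mfd_id]
  rfl

theorem mfd_chart_self (x : M) : mfd A A (chartAt A x) x = ContinuousLinearMap.id ℝ A := by
  exact mfderiv_extChartAt_self (I := 𝓘(ℝ, A))

theorem mfd_chart_symm_self (x : M) :
    mfd A A (chartAt A x).symm (chartAt A x x) = ContinuousLinearMap.id ℝ A := by
  ext v
  have := mfd_chart_symm_comp (mem_chart_source A x) v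
  rwa [mfd_chart_self] at this

/-- A map of two variables between manifolds, read in charts. -/
noncomputable def inCharts (a : M) (b : N) (c : P) (f : M → N → P) (p : A × B) : C :=
  chartAt C c (f ((chartAt A a).symm p.1) ((chartAt B b).symm p.2))

theorem contDiffAt_inCharts {a : M} {b : N} {c : P} {f : M → N → P} {u : A} {v : B}
    (hu : u ∈ (chartAt A a).target) (hv : v ∈ (chartAt B b).target)
    (hf : ContMDiffAt (𝓘(ℝ, A).prod 𝓘(ℝ, B)) 𝓘(ℝ, C) ∞ (Function.uncurry f)
      ((chartAt A a).symm u, (chartAt B b).symm v))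
    (hc : f ((chartAt A a).symm u) ((chartAt B b).symm v) ∈ (chartAt C c).source) :
    ContDiffAt ℝ ∞ (inCharts a b c f : A × B → C) (u, v) := by
  rw [← contMDiffAt_iff_contDiffAt]
  have h1 : ContMDiffAt 𝓘(ℝ, A × B) 𝓘(ℝ, A) ∞ (fun p : A × B => (chartAt A a).symm p.1) (u, v) :=
    ContMDiffAt.comp (u, v) (contMDiffAt_chart_symm hu) contDiff_fst.contMDiff.contMDiffAt
  have h2 : ContMDiffAt 𝓘(ℝ, A × B) 𝓘(ℝ, B) ∞ (fun p : A × B => (chartAt B b).symm p.2) (u, v) :=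
    ContMDiffAt.comp (u, v) (contMDiffAt_chart_symm hv) contDiff_snd.contMDiff.contMDiffAt
  exact ContMDiffAt.comp (u, v) (contMDiffAt_chart hc) (hf.comp (u, v) (h1.prodMk h2))

end Charts

theorem fderiv_prod_left {F : A × B → C} {u : A} {v : B} (hF : DifferentiableAt ℝ F (u, v))
    (X : A) : fderiv ℝ F (u, v) (X, 0) = fderiv ℝ (fun a => F (a, v)) u X := by
  have h := HasFDerivAt.comp u (f := fun a => (a, v)) hF.hasFDerivAt
    ((hasFDerivAt_id u).prodMk (hasFDerivAt_const v u))
  have h' : fderiv ℝ (fun a => F (a, v)) u = _ := h.fderiv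
  rw [h']
  simp

theorem fderiv_prod_right {F : A × B → C} {u : A} {v : B} (hF : DifferentiableAt ℝ F (u, v))
    (Y : B) : fderiv ℝ F (u, v) (0, Y) = fderiv ℝ (fun b => F (u, b)) v Y := by
  have h := HasFDerivAt.comp v (f := fun b => (u, b)) hF.hasFDerivAt
    ((hasFDerivAt_const u v).prodMk (hasFDerivAt_id v))
  have h' : fderiv ℝ (fun b => F (u, b)) v = _ := h.fderiv
  rw [h']
  simp

theorem contMDiffAt_left {f : M → N → P} {x : M} {y : N}
    (hf : ContMDiffAt (𝓘(ℝ, A).prod 𝓘(ℝ, B)) 𝓘(ℝ, C) ∞ (Function.uncurry f) (x, y)) :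
    ContMDiffAt 𝓘(ℝ, A) 𝓘(ℝ, C) ∞ (fun a => f a y) x :=
  ContMDiffAt.comp x (g := Function.uncurry f) (f := fun a => (a, y)) hf
    (contMDiffAt_id.prodMk contMDiffAt_const)

theorem contMDiffAt_right {f : M → N → P} {x : M} {y : N}
    (hf : ContMDiffAt (𝓘(ℝ, A).prod 𝓘(ℝ, B)) 𝓘(ℝ, C) ∞ (Function.uncurry f) (x, y)) :
    ContMDiffAt 𝓘(ℝ, B) 𝓘(ℝ, C) ∞ (fun b => f x b) y :=
  ContMDiffAt.comp y (g := Function.uncurry f) (f := fun b => (x, b)) hf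
    (contMDiffAt_const.prodMk contMDiffAt_id)

section Charts

variable [IsManifold 𝓘(ℝ, A) ∞ M] [IsManifold 𝓘(ℝ, B) ∞ N] [IsManifold 𝓘(ℝ, C) ∞ P]

theorem fderiv_inCharts_left {a : M} {b : N} {c : P} {f : M → N → P} {u : A} {v : B}
    (hu : u ∈ (chartAt A a).target) (hv : v ∈ (chartAt B b).target)
    (hf : ContMDiffAt (𝓘(ℝ, A).prod 𝓘(ℝ, B)) 𝓘(ℝ, C) ∞ (Function.uncurry f)
      ((chartAt A a).symm u, (chartAt B b).symm v))
    (hc : f ((chartAt A a).symm u) ((chartAt B b).symm v) ∈ (chartAt C c).source) (X : A) :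
    fderiv ℝ (inCharts a b c f : A × B → C) (u, v) (X, 0) =
      mfd C C (chartAt C c) (f ((chartAt A a).symm u) ((chartAt B b).symm v))
        (mfd A C (fun x => f x ((chartAt B b).symm v)) ((chartAt A a).symm u)
          (mfd A A (chartAt A a).symm u X)) := by
  rw [fderiv_prod_left ((contDiffAt_inCharts hu hv hf hc).differentiableAt (by simp)),
    ← mfd_eq_fderiv]
  have h1 := (contMDiffAt_left hf).mdifferentiableAt (by simp)
  have h2 := mdifferentiableAt_chart_symm hu
  rw [← mfd_comp_apply h1 h2]
  exact mfd_comp_apply (f := fun z => f ((chartAt A a).symm z) ((chartAt B b).symm v))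
    (mdifferentiableAt_chart hc) (h1.comp u h2) X

theorem fderiv_inCharts_right {a : M} {b : N} {c : P} {f : M → N → P} {u : A} {v : B}
    (hu : u ∈ (chartAt A a).target) (hv : v ∈ (chartAt B b).target)
    (hf : ContMDiffAt (𝓘(ℝ, A).prod 𝓘(ℝ, B)) 𝓘(ℝ, C) ∞ (Function.uncurry f)
      ((chartAt A a).symm u, (chartAt B b).symm v))
    (hc : f ((chartAt A a).symm u) ((chartAt B b).symm v) ∈ (chartAt C c).source) (Y : B) :
    fderiv ℝ (inCharts a b c f : A × B → C) (u, v) (0, Y) =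
      mfd C C (chartAt C c) (f ((chartAt A a).symm u) ((chartAt B b).symm v))
        (mfd B C (fun y => f ((chartAt A a).symm u) y) ((chartAt B b).symm v)
          (mfd B B (chartAt B b).symm v Y)) := by
  rw [fderiv_prod_right ((contDiffAt_inCharts hu hv hf hc).differentiableAt (by simp)),
    ← mfd_eq_fderiv]
  have h1 := (contMDiffAt_right hf).mdifferentiableAt (by simp)
  have h2 := mdifferentiableAt_chart_symm hv
  rw [← mfd_comp_apply h1 h2]
  exact mfd_comp_apply (f := fun z => f ((chartAt A a).symm u) ((chartAt B b).symm z))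
    (mdifferentiableAt_chart hc) (h1.comp v h2) Y

end Charts

end ModelDerivative

/-! ### The Lie bracket and smooth actions in charts -/

section Charts

open scoped Topology

/-- The derivative of `u ↦ DF(p u)(w u)`. -/
theorem hasFDerivAt_fderiv_apply {R S T : Type*} [NormedAddCommGroup R] [NormedSpace ℝ R]
    [NormedAddCommGroup S] [NormedSpace ℝ S] [NormedAddCommGroup T] [NormedSpace ℝ T]
    {F : S → T} {p w : R → S} {p' w' : R →L[ℝ] S} {x : R} (hF : ContDiffAt ℝ ∞ F (p x))
    (hp : HasFDerivAt p p' x) (hw : HasFDerivAt w w' x) :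
    HasFDerivAt (fun u => fderiv ℝ F (p u) (w u))
      ((fderiv ℝ F (p x)).comp w' + ((fderiv ℝ (fderiv ℝ F) (p x)).comp p').flip (w x)) x := by
  have h1 : HasFDerivAt (fderiv ℝ F) (fderiv ℝ (fderiv ℝ F) (p x)) (p x) :=
    ((hF.fderiv_right (m := ∞) (by simp)).differentiableAt (by simp)).hasFDerivAt
  exact (h1.comp x hp).clm_apply hw

theorem fderiv_fderiv_symm {S T : Type*} [NormedAddCommGroup S] [NormedSpace ℝ S]
    [NormedAddCommGroup T] [NormedSpace ℝ T] {F : S → T} {x : S} (hF : ContDiffAt ℝ ∞ F x)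
    (u v : S) : fderiv ℝ (fderiv ℝ F) x u v = fderiv ℝ (fderiv ℝ F) x v u :=
  (hF.isSymmSndFDerivAt (by simp; exact ENat.LEInfty.out)) u v

variable {V : Type*} [NormedAddCommGroup V] {K : Type*} [TopologicalSpace K] [ChartedSpace V K]
  [Group K]

variable (V K) in
/-- The coordinates of the unit of a Lie group in the chart around it. -/
noncomputable def oneChart : V := chartAt V (1 : K) 1

theorem oneChart_mem : oneChart V K ∈ (chartAt V (1 : K)).target := mem_chart_target V (1 : K)

@[simp] theorem chart_symm_oneChart : (chartAt V (1 : K)).symm (oneChart V K) = 1 :=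
  (chartAt V (1 : K)).left_inv (mem_chart_source V 1)

theorem chart_target_mem_nhds : (chartAt V (1 : K)).target ∈ 𝓝 (oneChart V K) :=
  (chartAt V (1 : K)).open_target.mem_nhds oneChart_mem

variable (V K) in
/-- The multiplication of a Lie group in the chart around the unit. -/
noncomputable def mulChart : V × V → V := inCharts (1 : K) (1 : K) (1 : K) (fun a b => a * b)

theorem mulChart_one_right {u : V} (hu : u ∈ (chartAt V (1 : K)).target) :
    mulChart V K (u, oneChart V K) = u := by
  simp [mulChart, inCharts, (chartAt V (1 : K)).right_inv hu]

variable [NormedSpace ℝ V]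

variable (K) in
/-- The antisymmetrised mixed second derivative of the multiplication at the unit. It is the Lie
bracket of the Lie algebra (see `lie_eq_chartBracket`). -/
noncomputable def chartBracket (X Y : V) : V :=
  fderiv ℝ (fderiv ℝ (mulChart V K)) (oneChart V K, oneChart V K) (X, 0) (0, Y) -
    fderiv ℝ (fderiv ℝ (mulChart V K)) (oneChart V K, oneChart V K) (Y, 0) (0, X)

variable [LieGroup 𝓘(ℝ, V) ∞ K]

theorem mfd_chart_symm_oneChart :
    mfd V V (chartAt V (1 : K)).symm (oneChart V K) = ContinuousLinearMap.id ℝ V :=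
  mfd_chart_symm_self (1 : K)

theorem contMDiff_mul_uncurry : ContMDiff (𝓘(ℝ, V).prod 𝓘(ℝ, V)) 𝓘(ℝ, V) ∞
    (Function.uncurry fun a b : K => a * b) := contMDiff_mul 𝓘(ℝ, V) ∞

theorem contMDiff_conj_uncurry : ContMDiff (𝓘(ℝ, V).prod 𝓘(ℝ, V)) 𝓘(ℝ, V) ∞
    (Function.uncurry fun a b : K => a * b * a⁻¹) :=
  ((contMDiff_fst.mul contMDiff_snd).mul contMDiff_fst.inv)

theorem contDiffAt_mulChart_right {u : V} (hu : u ∈ (chartAt V (1 : K)).target) :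
    ContDiffAt ℝ ∞ (mulChart V K) (u, oneChart V K) :=
  contDiffAt_inCharts hu oneChart_mem contMDiff_mul_uncurry.contMDiffAt
    (by simpa using (chartAt V (1 : K)).map_target hu)

theorem contDiffAt_mulChart_left {u : V} (hu : u ∈ (chartAt V (1 : K)).target) :
    ContDiffAt ℝ ∞ (mulChart V K) (oneChart V K, u) :=
  contDiffAt_inCharts oneChart_mem hu contMDiff_mul_uncurry.contMDiffAt
    (by simpa using (chartAt V (1 : K)).map_target hu)

theorem fderiv_mulChart_left (X : V) :
    fderiv ℝ (mulChart V K) (oneChart V K, oneChart V K) (X, 0) = X := by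
  rw [fderiv_prod_left ((contDiffAt_mulChart_left oneChart_mem).differentiableAt (by simp))]
  have : (fun a => mulChart V K (a, oneChart V K)) =ᶠ[𝓝 (oneChart V K)] fun a => a := by
    filter_upwards [chart_target_mem_nhds (V := V) (K := K)] with u hu
    exact mulChart_one_right hu
  rw [this.fderiv_eq, fderiv_fun_id]
  rfl

/-- In the chart around the unit, the left invariant vector field of `Y` is the partial derivative
of the multiplication in its second variable. -/
theorem fderiv_mulChart_right {u : V} (hu : u ∈ (chartAt V (1 : K)).target) (Y : V) :
    fderiv ℝ (mulChart V K) (u, oneChart V K) (0, Y) =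
      mfd V V (chartAt V (1 : K)) ((chartAt V (1 : K)).symm u)
        (mfd V V (fun k : K => (chartAt V (1 : K)).symm u * k) 1 Y) := by
  rw [mulChart, fderiv_inCharts_right hu oneChart_mem contMDiff_mul_uncurry.contMDiffAt
    (by simpa using (chartAt V (1 : K)).map_target hu), mfd_chart_symm_oneChart]
  simp

theorem fderiv_fderiv_mulChart (Y : V) :
    HasFDerivAt (fun u => fderiv ℝ (mulChart V K) (u, oneChart V K) (0, Y))
      (((fderiv ℝ (fderiv ℝ (mulChart V K)) (oneChart V K, oneChart V K)).comp
        (ContinuousLinearMap.inl ℝ V V)).flip (0, Y)) (oneChart V K) := by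
  have h := hasFDerivAt_fderiv_apply (p := fun u => (u, oneChart V K)) (w := fun _ => ((0 : V), Y))
    (contDiffAt_mulChart_right (V := V) (K := K) oneChart_mem)
    ((hasFDerivAt_id _).prodMk (hasFDerivAt_const _ _)) (hasFDerivAt_const _ _)
  refine h.congr_fderiv ?_
  ext v
  simp

theorem fderiv_mulChart_right_one (Y : V) :
    fderiv ℝ (mulChart V K) (oneChart V K, oneChart V K) (0, Y) = Y := by
  rw [fderiv_mulChart_right oneChart_mem, chart_symm_oneChart, mfd_chart_self]
  simp only [one_mul, mfd_id]
  rfl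

/-- The Lie bracket, which Mathlib defines through left invariant vector fields, in the chart around
the unit. -/
theorem lie_eq_chartBracket (X Y : GroupLieAlgebra 𝓘(ℝ, V) K) :
    ⁅X, Y⁆ = (chartBracket K (X : V) (Y : V) : V) := by
  -- the left invariant vector field of `Z` in the chart around the unit
  let L : V → V → V := fun Z => VectorField.mpullbackWithin 𝓘(ℝ, V) 𝓘(ℝ, V)
    (extChartAt 𝓘(ℝ, V) (1 : K)).symm (mulInvariantVectorField (I := 𝓘(ℝ, V)) (G := K) Z)
    (Set.range 𝓘(ℝ, V))
  have key : ∀ Z : V, L Z =ᶠ[𝓝 (oneChart V K)]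
      fun u => fderiv ℝ (mulChart V K) (u, oneChart V K) (0, Z) := by
    intro Z
    filter_upwards [chart_target_mem_nhds (V := V) (K := K)] with u hu
    rw [fderiv_mulChart_right hu]
    simp only [L, VectorField.mpullbackWithin, modelWithCornersSelf_coe, Set.range_id,
      mfderivWithin_univ]
    have h1 : (mfd V V (chartAt V (1 : K)).symm u).inverse =
        mfd V V (chartAt V (1 : K)) ((chartAt V (1 : K)).symm u) := by
      apply ContinuousLinearMap.inverse_eq
      · ext v
        have := mfd_chart_symm_comp ((chartAt V (1 : K)).map_target hu) v
        rw [(chartAt V (1 : K)).right_inv hu] at this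
        exact this
      · ext v
        exact mfd_chart_comp_symm hu v
    rw [← h1]
    rfl
  have main : ∀ A B : V, ContinuousLinearMap.id ℝ V
      (VectorField.lieBracket ℝ (L A) (L B) (oneChart V K)) = chartBracket K A B := by
    intro A B
    rw [Filter.EventuallyEq.lieBracket_vectorField_eq (key A) (key B), VectorField.lieBracket,
      (fderiv_fderiv_mulChart _).fderiv, (fderiv_fderiv_mulChart _).fderiv,
      fderiv_mulChart_right_one, fderiv_mulChart_right_one]
    simp [chartBracket]
  have hset : (extChartAt 𝓘(ℝ, V) (1 : K)).symm ⁻¹' Set.univ ∩ Set.range 𝓘(ℝ, V) = Set.univ := by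
    simp
  rw [GroupLieAlgebra.bracket_def, ← VectorField.mlieBracketWithin_univ,
    VectorField.mlieBracketWithin_apply, hset]
  change (mfd V V (chartAt V (1 : K)) 1).inverse (VectorField.lieBracketWithin ℝ (L X) (L Y)
    Set.univ (oneChart V K)) = _
  rw [VectorField.lieBracketWithin_univ, mfd_chart_self, ContinuousLinearMap.inverse_id]
  exact main X Y

end Charts

/-! ### Fundamental vector fields of smooth actions -/

section Action

open scoped Topology

variable {V : Type*} [NormedAddCommGroup V] [NormedSpace ℝ V]
  {K : Type*} [TopologicalSpace K] [ChartedSpace V K] [Group K]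
  {W : Type*} [NormedAddCommGroup W] [NormedSpace ℝ W]
  {N : Type*} [TopologicalSpace N] [ChartedSpace W N]

variable (V W) in
/-- A smooth action of a Lie group, as a predicate on a map of two variables, so that it applies
also to actions which are not instances. -/
structure IsSmoothAction (act : K → N → N) : Prop where
  one_act : ∀ x, act 1 x = x
  mul_act : ∀ a b x, act (a * b) x = act a (act b x)
  contMDiff : ContMDiff (𝓘(ℝ, V).prod 𝓘(ℝ, W)) 𝓘(ℝ, W) ∞ (Function.uncurry act)

variable (V W) in
/-- The fundamental vector field of an action: the velocity of `k ↦ k • x` at the unit in the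
direction `X`. -/
noncomputable def fundField (act : K → N → N) (X : V) (x : N) : W :=
  mfd V W (fun k => act k x) 1 X

variable (V W) in
/-- An action, in the chart of the group around the unit and the chart of the space around `x₀`. -/
noncomputable def actChart (act : K → N → N) (x₀ : N) : V × W → W := inCharts (1 : K) x₀ x₀ act

variable (V W) in
/-- The fundamental vector field in the chart around `x₀` (see `fieldInChart_eq`). -/
noncomputable def fieldInChart (act : K → N → N) (x₀ : N) (X : V) (y : W) : W :=
  fderiv ℝ (actChart V W act x₀) (oneChart V K, y) (X, 0)

namespace IsSmoothAction

variable {act : K → N → N}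

theorem contMDiff_left (h : IsSmoothAction V W act) (x : N) :
    ContMDiff 𝓘(ℝ, V) 𝓘(ℝ, W) ∞ (fun k => act k x) :=
  fun _ => contMDiffAt_left h.contMDiff.contMDiffAt

theorem contMDiff_right (h : IsSmoothAction V W act) (k : K) :
    ContMDiff 𝓘(ℝ, W) 𝓘(ℝ, W) ∞ (fun x => act k x) :=
  fun _ => contMDiffAt_right h.contMDiff.contMDiffAt

theorem mdifferentiableAt_left (h : IsSmoothAction V W act) (x : N) (k : K) :
    MDifferentiableAt 𝓘(ℝ, V) 𝓘(ℝ, W) (fun k => act k x) k :=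
  (h.contMDiff_left x).mdifferentiable (by simp) k

theorem mdifferentiableAt_right (h : IsSmoothAction V W act) (k : K) (x : N) :
    MDifferentiableAt 𝓘(ℝ, W) 𝓘(ℝ, W) (fun x => act k x) x :=
  (h.contMDiff_right k).mdifferentiable (by simp) x

theorem actChart_one (h : IsSmoothAction V W act) {x₀ : N} {y : W}
    (hy : y ∈ (chartAt W x₀).target) : actChart V W act x₀ (oneChart V K, y) = y := by
  simp [actChart, inCharts, h.one_act, (chartAt W x₀).right_inv hy]

/-- Near the unit, the action does not leave the domain of the chart. -/
theorem eventually_act_mem (h : IsSmoothAction V W act) {x₀ x : N}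
    (hx : x ∈ (chartAt W x₀).source) :
    ∀ᶠ v in 𝓝 (oneChart V K), act ((chartAt V (1 : K)).symm v) x ∈ (chartAt W x₀).source := by
  have h1 : ContinuousAt (fun v => act ((chartAt V (1 : K)).symm v) x) (oneChart V K) :=
    ((h.contMDiff_left x).continuous.continuousAt).comp
      ((chartAt V (1 : K)).continuousAt_symm oneChart_mem)
  refine h1.eventually_mem ((chartAt W x₀).open_source.mem_nhds ?_)
  simpa [h.one_act] using hx

variable [LieGroup 𝓘(ℝ, V) ∞ K]

/-- The orbit map of `x` intertwines left translations of the group with the action. -/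
theorem mfd_orbit (h : IsSmoothAction V W act) (k : K) (x : N) (X : V) :
    mfd V W (fun a => act a x) k (mfd V V (fun a : K => k * a) 1 X) =
      mfd W W (fun z => act k z) x (fundField V W act X x) := by
  have h1 : MDifferentiableAt 𝓘(ℝ, V) 𝓘(ℝ, V) (fun a : K => k * a) 1 :=
    (contMDiff_mul_left (I := 𝓘(ℝ, V)) (n := ∞) (a := k)).mdifferentiable (by simp) 1
  have h2 := mfd_comp_apply (g := fun a => act a x) (h.mdifferentiableAt_left x (k * 1)) h1 X
  have h3 := mfd_comp_apply (g := fun z => act k z) (f := fun a => act a x) (x := (1 : K))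
    (h.mdifferentiableAt_right k _) (h.mdifferentiableAt_left x 1) X
  rw [mul_one] at h2
  rw [h.one_act] at h3
  rw [← h2, fundField, ← h3]
  simp only [h.mul_act]

variable [IsManifold 𝓘(ℝ, W) ∞ N]

theorem contDiffAt_actChart (h : IsSmoothAction V W act) {x₀ : N} {u : V} {y : W}
    (hu : u ∈ (chartAt V (1 : K)).target) (hy : y ∈ (chartAt W x₀).target)
    (hs : act ((chartAt V (1 : K)).symm u) ((chartAt W x₀).symm y) ∈ (chartAt W x₀).source) :
    ContDiffAt ℝ ∞ (actChart V W act x₀) (u, y) :=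
  contDiffAt_inCharts hu hy h.contMDiff.contMDiffAt hs

theorem contDiffAt_actChart_one (h : IsSmoothAction V W act) {x₀ : N} {y : W}
    (hy : y ∈ (chartAt W x₀).target) :
    ContDiffAt ℝ ∞ (actChart V W act x₀) (oneChart V K, y) :=
  h.contDiffAt_actChart oneChart_mem hy
    (by simpa [h.one_act] using (chartAt W x₀).map_target hy)

theorem fderiv_actChart_right (h : IsSmoothAction V W act) {x₀ : N} {y : W}
    (hy : y ∈ (chartAt W x₀).target) (v : W) :
    fderiv ℝ (actChart V W act x₀) (oneChart V K, y) (0, v) = v := by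
  rw [fderiv_prod_right ((h.contDiffAt_actChart_one hy).differentiableAt (by simp))]
  have : (fun b => actChart V W act x₀ (oneChart V K, b)) =ᶠ[𝓝 y] fun b => b := by
    filter_upwards [(chartAt W x₀).open_target.mem_nhds hy] with z hz using h.actChart_one hz
  rw [this.fderiv_eq, fderiv_fun_id]
  rfl

theorem fieldInChart_eq (h : IsSmoothAction V W act) {x₀ : N} {y : W}
    (hy : y ∈ (chartAt W x₀).target) (X : V) :
    fieldInChart V W act x₀ X y =
      mfd W W (chartAt W x₀) ((chartAt W x₀).symm y)
        (fundField V W act X ((chartAt W x₀).symm y)) := by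
  rw [fieldInChart, actChart, fderiv_inCharts_left oneChart_mem hy h.contMDiff.contMDiffAt
    (by simpa [h.one_act] using (chartAt W x₀).map_target hy), mfd_chart_symm_oneChart]
  simp [h.one_act, fundField]

theorem contDiffOn_fieldInChart (h : IsSmoothAction V W act) (x₀ : N) (X : V) :
    ContDiffOn ℝ ∞ (fieldInChart V W act x₀ X) (chartAt W x₀).target := by
  intro y hy
  have h1 : ContDiffAt ℝ ∞ (fderiv ℝ (actChart V W act x₀)) (oneChart V K, y) :=
    (h.contDiffAt_actChart_one hy).fderiv_right (by simp)
  have h2 : ContDiffAt ℝ ∞ (fun z : W => (oneChart V K, z)) y :=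
    contDiffAt_const.prodMk contDiffAt_id
  exact ((ContDiffAt.comp y (f := fun z : W => (oneChart V K, z)) h1 h2).clm_apply
    contDiffAt_const).contDiffWithinAt

/-- The derivative of a fundamental vector field is the mixed second derivative of the action. -/
theorem fderiv_fieldInChart (h : IsSmoothAction V W act) {x₀ : N} {y : W}
    (hy : y ∈ (chartAt W x₀).target) (X : V) (v : W) :
    fderiv ℝ (fieldInChart V W act x₀ X) y v =
      fderiv ℝ (fderiv ℝ (actChart V W act x₀)) (oneChart V K, y) (X, 0) (0, v) := by
  have h1 := (hasFDerivAt_fderiv_apply (p := fun z : W => (oneChart V K, z))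
    (w := fun _ => (X, (0 : W))) (h.contDiffAt_actChart_one hy)
    ((hasFDerivAt_const _ _).prodMk (hasFDerivAt_id _)) (hasFDerivAt_const _ _)).fderiv
  have h2 : fderiv ℝ (fieldInChart V W act x₀ X) y = _ := h1
  rw [h2, fderiv_fderiv_symm (h.contDiffAt_actChart_one hy)]
  simp

/-- The Lie bracket of fundamental vector fields, in a chart. Since the action is a left action,
the map from elements of the Lie algebra to vector fields is an antihomomorphism: the right hand
side is the negative of the bracket of the two fields. -/
theorem fieldInChart_bracket (h : IsSmoothAction V W act) {x₀ : N} {y : W}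
    (hy : y ∈ (chartAt W x₀).target) (X Y : V) :
    fieldInChart V W act x₀ (chartBracket K X Y) y =
      fderiv ℝ (fieldInChart V W act x₀ X) y (fieldInChart V W act x₀ Y y) -
        fderiv ℝ (fieldInChart V W act x₀ Y) y (fieldInChart V W act x₀ X y) := by
  set F := actChart V W act x₀ with hF
  set m := mulChart V K with hm
  set e := oneChart V K with he
  have hFy := h.contDiffAt_actChart_one hy
  -- the action law, differentiated in the second group variable
  have key : ∀ Y : V, (fun u => fderiv ℝ F (u, y) (fderiv ℝ m (u, e) (0, Y), 0)) =ᶠ[𝓝 e]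
      fun u => fderiv ℝ F (u, y) (0, fieldInChart V W act x₀ Y y) := by
    intro Y
    have hev := h.eventually_act_mem ((chartAt W x₀).map_target hy)
    filter_upwards [hev, chart_target_mem_nhds (V := V) (K := K)] with u hu1 hu
    have hFu := (h.contDiffAt_actChart hu hy hu1).differentiableAt (by simp)
    have hmu := (contDiffAt_mulChart_right (V := V) (K := K) hu).differentiableAt (by simp)
    have hl : HasFDerivAt (fun v => F (m (u, v), y))
        ((fderiv ℝ F (u, y)).comp (((fderiv ℝ m (u, e)).comp
          ((0 : V →L[ℝ] V).prod (ContinuousLinearMap.id ℝ V))).prod 0)) e := by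
      have h1 : HasFDerivAt (fun v => m (u, v)) ((fderiv ℝ m (u, e)).comp
          ((0 : V →L[ℝ] V).prod (ContinuousLinearMap.id ℝ V))) e :=
        HasFDerivAt.comp e (f := fun v => (u, v)) hmu.hasFDerivAt
          ((hasFDerivAt_const u e).prodMk (hasFDerivAt_id e))
      have h2 : m (u, e) = u := mulChart_one_right hu
      refine HasFDerivAt.comp e (g := F) (f := fun v => (m (u, v), y)) ?_
        (h1.prodMk (hasFDerivAt_const y e))
      simpa only [h2] using hFu.hasFDerivAt
    have hr : HasFDerivAt (fun v => F (u, F (v, y)))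
        ((fderiv ℝ F (u, y)).comp ((0 : V →L[ℝ] V).prod ((fderiv ℝ F (e, y)).comp
          ((ContinuousLinearMap.id ℝ V).prod 0)))) e := by
      have h1 : HasFDerivAt (fun v => F (v, y)) ((fderiv ℝ F (e, y)).comp
          ((ContinuousLinearMap.id ℝ V).prod 0)) e :=
        HasFDerivAt.comp e (f := fun v => (v, y)) (hFy.differentiableAt (by simp)).hasFDerivAt
          ((hasFDerivAt_id e).prodMk (hasFDerivAt_const y e))
      have h2 : F (e, y) = y := h.actChart_one hy
      refine HasFDerivAt.comp e (g := F) (f := fun v => (u, F (v, y))) ?_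
        ((hasFDerivAt_const u e).prodMk h1)
      simpa only [h2] using hFu.hasFDerivAt
    have heq : (fun v => F (m (u, v), y)) =ᶠ[𝓝 e] fun v => F (u, F (v, y)) := by
      have hK : ∀ᶠ v in 𝓝 e, (chartAt V (1 : K)).symm u * (chartAt V (1 : K)).symm v ∈
          (chartAt V (1 : K)).source := by
        have : ContinuousMul K := continuousMul_of_contMDiffMul 𝓘(ℝ, V) ∞
        have hc : ContinuousAt (fun v => (chartAt V (1 : K)).symm u * (chartAt V (1 : K)).symm v)
          e := continuousAt_const.mul ((chartAt V (1 : K)).continuousAt_symm oneChart_mem)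
        refine hc.eventually_mem ((chartAt V (1 : K)).open_source.mem_nhds ?_)
        simpa [he] using (chartAt V (1 : K)).map_target hu
      filter_upwards [hK, hev] with v hv1 hv2
      simp only [hF, hm, actChart, mulChart, inCharts, (chartAt V (1 : K)).left_inv hv1,
        (chartAt W x₀).left_inv hv2, h.mul_act]
    have := congrArg (fun L : V →L[ℝ] W => L Y) ((hl.congr_of_eventuallyEq heq.symm).unique hr)
    simpa [fieldInChart] using this
  -- the same relation, differentiated also in the first group variable
  have key2 : ∀ X Y : V, fderiv ℝ (fderiv ℝ F) (e, y) (X, 0) (Y, 0) +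
      fderiv ℝ F (e, y) (fderiv ℝ (fderiv ℝ m) (e, e) (X, 0) (0, Y), 0) =
      fderiv ℝ (fieldInChart V W act x₀ X) y (fieldInChart V W act x₀ Y y) := by
    intro X Y
    have hp : HasFDerivAt (fun u : V => (u, y)) ((ContinuousLinearMap.id ℝ V).prod 0) e :=
      (hasFDerivAt_id e).prodMk (hasFDerivAt_const y e)
    have h1 := hasFDerivAt_fderiv_apply (F := F) (p := fun u : V => (u, y))
      (w := fun u => (fderiv ℝ m (u, e) (0, Y), (0 : W))) hFy hp
      ((fderiv_fderiv_mulChart Y).prodMk (hasFDerivAt_const (0 : W) e))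
    have h2 := hasFDerivAt_fderiv_apply (F := F) (p := fun u : V => (u, y))
      (w := fun _ => ((0 : V), fieldInChart V W act x₀ Y y)) hFy hp (hasFDerivAt_const _ e)
    have h3 := congrArg (fun L : V →L[ℝ] W => L X)
      ((h1.congr_of_eventuallyEq (key Y).symm).unique h2)
    rw [h.fderiv_fieldInChart hy]
    have h4 : fderiv ℝ m (oneChart V K, e) (0, Y) = Y := fderiv_mulChart_right_one Y
    simp only [add_apply, ContinuousLinearMap.comp_apply, ContinuousLinearMap.flip_apply,
      ContinuousLinearMap.prod_apply, zero_apply, ContinuousLinearMap.inl_apply,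
      ContinuousLinearMap.id_apply, map_zero, zero_add] at h3
    rw [h4] at h3
    rw [add_comm]
    simpa using h3
  rw [← key2 X Y, ← key2 Y X, fderiv_fderiv_symm hFy (Y, 0) (X, 0)]
  rw [add_sub_add_left_eq_sub, ← map_sub, fieldInChart, chartBracket]
  simp only [Prod.mk_sub_mk, sub_zero]
  rfl

end IsSmoothAction

end Action

/-! ### Homomorphisms of Lie groups and the adjoint representation -/

section Adjoint

open scoped Topology

variable {V : Type*} [NormedAddCommGroup V] [NormedSpace ℝ V]
  {K : Type*} [TopologicalSpace K] [ChartedSpace V K] [Group K]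
  {W : Type*} [NormedAddCommGroup W] [NormedSpace ℝ W]
  {L : Type*} [TopologicalSpace L] [ChartedSpace W L] [Group L] [LieGroup 𝓘(ℝ, W) ∞ L]

theorem isSmoothAction_hom {c : K →* L} (hc : ContMDiff 𝓘(ℝ, V) 𝓘(ℝ, W) ∞ c) :
    IsSmoothAction V W (fun (k : K) (x : L) => c k * x) where
  one_act x := by simp
  mul_act a b x := by simp [mul_assoc]
  contMDiff := (hc.comp contMDiff_fst).mul contMDiff_snd

theorem isSmoothAction_mul : IsSmoothAction W W (fun (k : L) (x : L) => k * x) :=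
  isSmoothAction_hom (c := MonoidHom.id L) contMDiff_id

theorem fundField_hom {c : K →* L} (hc : ContMDiff 𝓘(ℝ, V) 𝓘(ℝ, W) ∞ c) (X : V) (x : L) :
    fundField V W (fun (k : K) (x : L) => c k * x) X x =
      fundField W W (fun (k : L) (x : L) => k * x) (mfd V W c 1 X) x := by
  have h := mfd_comp_apply (g := fun k : L => k * x) (f := c) (x := (1 : K))
    (isSmoothAction_mul.mdifferentiableAt_left x (c 1)) (hc.mdifferentiable (by simp) 1) X
  rw [map_one] at h
  exact h

variable (V) in
/-- The adjoint representation: the derivative of the conjugation by `k` at the unit. -/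
noncomputable def adjoint (k : K) : V →L[ℝ] V := mfd V V (fun x : K => k * x * k⁻¹) 1

theorem adjoint_one : adjoint V (1 : K) = ContinuousLinearMap.id ℝ V := by
  simp [adjoint, mfd_id]

variable [LieGroup 𝓘(ℝ, V) ∞ K]

/-- The derivative of a homomorphism of Lie groups preserves Lie brackets. -/
theorem mfd_chartBracket {c : K →* L} (hc : ContMDiff 𝓘(ℝ, V) 𝓘(ℝ, W) ∞ c) (X Y : V) :
    mfd V W c 1 (chartBracket K X Y) = chartBracket L (mfd V W c 1 X) (mfd V W c 1 Y) := by
  have h1 := isSmoothAction_hom hc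
  have h2 := isSmoothAction_mul (W := W) (L := L)
  have hf : ∀ Z : V, ∀ y ∈ (chartAt W (1 : L)).target,
      fieldInChart V W (fun (k : K) (x : L) => c k * x) 1 Z y =
        fieldInChart W W (fun (k : L) (x : L) => k * x) 1 (mfd V W c 1 Z) y := by
    intro Z y hy
    rw [h1.fieldInChart_eq hy, h2.fieldInChart_eq hy, fundField_hom hc]
  have hd : ∀ Z : V, fderiv ℝ (fieldInChart V W (fun (k : K) (x : L) => c k * x) 1 Z)
      (oneChart W L) = fderiv ℝ (fieldInChart W W (fun (k : L) (x : L) => k * x) 1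
        (mfd V W c 1 Z)) (oneChart W L) := by
    intro Z
    apply Filter.EventuallyEq.fderiv_eq
    filter_upwards [chart_target_mem_nhds (V := W) (K := L)] with y hy using hf Z y hy
  have h0 : ∀ Z : W, fieldInChart W W (fun (k : L) (x : L) => k * x) 1 Z (oneChart W L) = Z :=
    fun Z => fderiv_mulChart_left Z
  have e1 := h1.fieldInChart_bracket (x₀ := (1 : L)) oneChart_mem X Y
  have e2 := h2.fieldInChart_bracket (x₀ := (1 : L)) oneChart_mem (mfd V W c 1 X) (mfd V W c 1 Y)
  rw [hf _ _ oneChart_mem, hf _ _ oneChart_mem, hf _ _ oneChart_mem, hd, hd, ← e2, h0, h0] at e1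
  exact e1

theorem mdifferentiableAt_conj (k x : K) :
    MDifferentiableAt 𝓘(ℝ, V) 𝓘(ℝ, V) (fun x : K => k * x * k⁻¹) x :=
  (contMDiffAt_right (f := fun a b : K => a * b * a⁻¹)
    contMDiff_conj_uncurry.contMDiffAt).mdifferentiableAt (by simp)

theorem adjoint_mul (k l : K) (X : V) : adjoint V (k * l) X = adjoint V k (adjoint V l X) := by
  have h := mfd_comp_apply (g := fun x : K => k * x * k⁻¹) (f := fun x : K => l * x * l⁻¹)
    (x := (1 : K)) (mdifferentiableAt_conj (V := V) k _) (mdifferentiableAt_conj (V := V) l 1) X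
  rw [adjoint, adjoint, adjoint]
  simp only [mul_one, mul_inv_cancel] at h
  rw [← h]
  simp only [mul_assoc, mul_inv_rev]

theorem adjoint_eq_fderiv {k : K} (hk : k ∈ (chartAt V (1 : K)).source) (Y : V) :
    adjoint V k Y = fderiv ℝ (inCharts (1 : K) (1 : K) (1 : K) (fun a b : K => a * b * a⁻¹) :
      V × V → V) (chartAt V (1 : K) k, oneChart V K) (0, Y) := by
  rw [fderiv_inCharts_right ((chartAt V (1 : K)).map_source hk) oneChart_mem
    contMDiff_conj_uncurry.contMDiffAt (by simp), mfd_chart_symm_oneChart,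
    (chartAt V (1 : K)).left_inv hk]
  simp [mfd_chart_self, adjoint]

/-- The derivative of the adjoint representation at the unit is the Lie bracket. -/
theorem mdifferentiableAt_adjoint_one (Y : V) :
    MDifferentiableAt 𝓘(ℝ, V) 𝓘(ℝ, V) (fun k : K => adjoint V k Y) 1 ∧
      ∀ X : V, mfd V V (fun k : K => adjoint V k Y) 1 X = chartBracket K X Y := by
  set n : V × V → V := inCharts (1 : K) (1 : K) (1 : K) (fun a b : K => a * b * a⁻¹) with hn
  set m := mulChart V K with hm
  set e := oneChart V K with he
  have hnu : ∀ u ∈ (chartAt V (1 : K)).target, ContDiffAt ℝ ∞ n (u, e) := fun u hu =>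
    contDiffAt_inCharts hu oneChart_mem contMDiff_conj_uncurry.contMDiffAt (by simp [he])
  have hnd := hasFDerivAt_fderiv_apply (F := n) (p := fun u : V => (u, e))
    (w := fun _ => ((0 : V), Y)) (hnu e oneChart_mem)
    ((hasFDerivAt_id e).prodMk (hasFDerivAt_const e e)) (hasFDerivAt_const _ e)
  set D := fderiv ℝ (fun u => fderiv ℝ n (u, e) (0, Y)) e with hD
  have hnd' : HasFDerivAt (fun u => fderiv ℝ n (u, e) (0, Y)) D e :=
    hnd.differentiableAt.hasFDerivAt
  have hne : fderiv ℝ n (e, e) (0, Y) = Y := by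
    have := adjoint_eq_fderiv (V := V) (mem_chart_source V (1 : K)) Y
    rw [adjoint_one] at this
    exact this.symm
  -- the relation `(k l k⁻¹) k = k l`, differentiated in `l`
  have key : (fun u => fderiv ℝ m (e, u) (fderiv ℝ n (u, e) (0, Y), 0)) =ᶠ[𝓝 e]
      fun u => fderiv ℝ m (u, e) (0, Y) := by
    filter_upwards [chart_target_mem_nhds (V := V) (K := K)] with u hu
    have hmu := (contDiffAt_mulChart_right (V := V) (K := K) hu).differentiableAt (by simp)
    have hmu' := (contDiffAt_mulChart_left (V := V) (K := K) hu).differentiableAt (by simp)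
    have hpr : HasFDerivAt (fun v : V => (u, v)) ((0 : V →L[ℝ] V).prod
        (ContinuousLinearMap.id ℝ V)) e := (hasFDerivAt_const u e).prodMk (hasFDerivAt_id e)
    have hr : HasFDerivAt (𝕜 := ℝ) (fun v => m (u, v)) _ e := hmu.hasFDerivAt.comp e hpr
    have hnv : HasFDerivAt (𝕜 := ℝ) (fun v => n (u, v)) _ e :=
      ((hnu u hu).differentiableAt (by simp)).hasFDerivAt.comp e hpr
    have hn0 : n (u, e) = e := by simp [hn, he, inCharts, oneChart]
    have hl0 : HasFDerivAt m (fderiv ℝ m (e, u)) (n (u, e), u) := by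
      simpa only [hn0] using hmu'.hasFDerivAt
    have hl := HasFDerivAt.comp e (g := m) (f := fun v => (n (u, v), u)) hl0
      (hnv.prodMk (hasFDerivAt_const u e))
    have heq : (fun v => m (n (u, v), u)) =ᶠ[𝓝 e] fun v => m (u, v) := by
      have hK : ∀ᶠ v in 𝓝 e, (chartAt V (1 : K)).symm u * (chartAt V (1 : K)).symm v *
          ((chartAt V (1 : K)).symm u)⁻¹ ∈ (chartAt V (1 : K)).source := by
        have hc : ContinuousAt (fun v => (chartAt V (1 : K)).symm u * (chartAt V (1 : K)).symm v *
            ((chartAt V (1 : K)).symm u)⁻¹) e :=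
          ((mdifferentiableAt_conj (V := V) ((chartAt V (1 : K)).symm u)
            ((chartAt V (1 : K)).symm e)).continuousAt).comp
            ((chartAt V (1 : K)).continuousAt_symm oneChart_mem)
        refine hc.eventually_mem ((chartAt V (1 : K)).open_source.mem_nhds ?_)
        simp [he]
      filter_upwards [hK] with v hv
      simp only [hm, hn, mulChart, inCharts, (chartAt V (1 : K)).left_inv hv]
      simp
    have := congrArg (fun T : V →L[ℝ] V => T Y) ((hl.congr_of_eventuallyEq heq.symm).unique hr)
    simpa using this
  have hval : ∀ X, D X = chartBracket K X Y := by
    intro X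
    have h1 := hasFDerivAt_fderiv_apply (F := m) (p := fun u : V => (e, u))
      (w := fun u => (fderiv ℝ n (u, e) (0, Y), (0 : V)))
      (contDiffAt_mulChart_left (V := V) (K := K) oneChart_mem)
      ((hasFDerivAt_const e e).prodMk (hasFDerivAt_id e))
      (hnd'.prodMk (hasFDerivAt_const (0 : V) e))
    have h2 := congrArg (fun T : V →L[ℝ] V => T X)
      ((h1.congr_of_eventuallyEq key.symm).unique (fderiv_fderiv_mulChart Y))
    have h3 : fderiv ℝ m (e, e) (D X, 0) = D X := fderiv_mulChart_left (D X)
    simp only [add_apply, ContinuousLinearMap.comp_apply, ContinuousLinearMap.flip_apply,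
      ContinuousLinearMap.prod_apply, zero_apply, ContinuousLinearMap.inl_apply,
      ContinuousLinearMap.id_apply] at h2
    have h4 : fderiv ℝ n (oneChart V K, e) (0, Y) = Y := hne
    rw [h3, h4] at h2
    rw [chartBracket, eq_sub_iff_add_eq, fderiv_fderiv_symm
      (contDiffAt_mulChart_left (V := V) (K := K) oneChart_mem) (Y, 0) (0, X)]
    exact h2
  have hcongr : (fun k : K => adjoint V k Y) =ᶠ[𝓝 1]
      fun k => (fun u => fderiv ℝ n (u, e) (0, Y)) (chartAt V (1 : K) k) := by
    filter_upwards [(chartAt V (1 : K)).open_source.mem_nhds (mem_chart_source V 1)] with k hk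
      using adjoint_eq_fderiv hk Y
  have hd1 : MDifferentiableAt 𝓘(ℝ, V) 𝓘(ℝ, V) (fun u => fderiv ℝ n (u, e) (0, Y))
      (chartAt V (1 : K) 1) := hnd'.differentiableAt.mdifferentiableAt
  have hd2 := mdifferentiableAt_chart (A := V) (mem_chart_source V (1 : K))
  refine ⟨(MDifferentiableAt.comp (1 : K) hd1 hd2).congr_of_eventuallyEq hcongr, fun X => ?_⟩
  rw [mfd_congr hcongr, mfd_comp_apply hd1 hd2, mfd_chart_self, mfd_eq_fderiv, ← hval]
  rfl

theorem mdifferentiableAt_inv_mul (k : K) :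
    MDifferentiableAt 𝓘(ℝ, V) 𝓘(ℝ, V) (fun a : K => k⁻¹ * a) k :=
  (contMDiff_mul_left (I := 𝓘(ℝ, V)) (n := ∞) (a := k⁻¹)).mdifferentiable (by simp) k

theorem adjoint_eq_translate (k : K) (Y : V) :
    (fun a : K => adjoint V a Y) = fun a => adjoint V k (adjoint V (k⁻¹ * a) Y) := by
  funext a
  rw [← adjoint_mul]
  simp

theorem mdifferentiableAt_adjoint (Y : V) (k : K) :
    MDifferentiableAt 𝓘(ℝ, V) 𝓘(ℝ, V) (fun k : K => adjoint V k Y) k := by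
  rw [adjoint_eq_translate k]
  have h1 := (mdifferentiableAt_adjoint_one (K := K) Y).1
  rw [← inv_mul_cancel k] at h1
  have h2 : MDifferentiableAt 𝓘(ℝ, V) 𝓘(ℝ, V) (fun a : K => adjoint V (k⁻¹ * a) Y) k :=
    MDifferentiableAt.comp k (g := fun a : K => adjoint V a Y) h1 (mdifferentiableAt_inv_mul k)
  exact (adjoint V k).differentiableAt.mdifferentiableAt.comp k h2

theorem mfd_adjoint (Y : V) (k : K) (X : V) :
    mfd V V (fun k : K => adjoint V k Y) k X =
      adjoint V k (chartBracket K (mfd V V (fun a : K => k⁻¹ * a) k X) Y) := by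
  rw [adjoint_eq_translate k]
  have h1 := (mdifferentiableAt_adjoint_one (K := K) Y).1
  rw [← inv_mul_cancel k] at h1
  have h2 : MDifferentiableAt 𝓘(ℝ, V) 𝓘(ℝ, V) (fun a : K => adjoint V (k⁻¹ * a) Y) k :=
    MDifferentiableAt.comp k (g := fun a : K => adjoint V a Y) h1 (mdifferentiableAt_inv_mul k)
  rw [mfd_comp_apply (g := adjoint V k) (adjoint V k).differentiableAt.mdifferentiableAt h2,
    mfd_comp_apply (g := fun a : K => adjoint V a Y) h1 (mdifferentiableAt_inv_mul k),
    mfd_eq_fderiv, ContinuousLinearMap.fderiv, inv_mul_cancel, (mdifferentiableAt_adjoint_one Y).2]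

end Adjoint

/-! ### An invariant inner product on the Lie algebra of a compact group -/

section InvariantForm

open scoped Topology
open MeasureTheory

variable {V : Type*} [NormedAddCommGroup V] [NormedSpace ℝ V]
  {K : Type*} [TopologicalSpace K] [ChartedSpace V K] [Group K] [LieGroup 𝓘(ℝ, V) ∞ K]

theorem continuous_adjoint (Y : V) : Continuous fun k : K => adjoint V k Y :=
  continuous_iff_continuousAt.2 fun k => (mdifferentiableAt_adjoint Y k).continuousAt

theorem adjoint_inv_adjoint (k : K) (Y : V) : adjoint V k (adjoint V k⁻¹ Y) = Y := by
  rw [← adjoint_mul, mul_inv_cancel, adjoint_one]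
  rfl

theorem exists_posDef_form (V : Type*) [AddCommGroup V] [Module ℝ V] [FiniteDimensional ℝ V] :
    ∃ β : V →ₗ[ℝ] V →ₗ[ℝ] ℝ, (∀ x y, β x y = β y x) ∧ ∀ x, x ≠ 0 → 0 < β x x := by
  let b := Module.finBasis ℝ V
  refine ⟨∑ i, (b.coord i).smulRight (b.coord i), fun x y => ?_, fun x hx => ?_⟩
  · simp [LinearMap.sum_apply, mul_comm]
  · obtain ⟨i, hi⟩ : ∃ i, b.coord i x ≠ 0 := by
      by_contra! h
      exact hx (b.ext_elem fun i => by simpa using h i)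
    simp only [LinearMap.sum_apply, LinearMap.smulRight_apply, LinearMap.smul_apply, smul_eq_mul]
    exact Finset.sum_pos' (fun j _ => mul_self_nonneg _)
      ⟨i, Finset.mem_univ _, mul_self_pos.mpr hi⟩

variable [FiniteDimensional ℝ V]

/-- Averaging over a compact Lie group yields an inner product invariant under the adjoint
representation. -/
theorem exists_adjoint_invariant_form [CompactSpace K] :
    ∃ Q : V →ₗ[ℝ] V →ₗ[ℝ] ℝ, (∀ x y, Q x y = Q y x) ∧ (∀ x, x ≠ 0 → 0 < Q x x) ∧
      ∀ (k : K) (x y), Q (adjoint V k x) (adjoint V k y) = Q x y := by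
  obtain ⟨β, hβs, hβp⟩ := exists_posDef_form V
  have : IsTopologicalGroup K := topologicalGroup_of_lieGroup 𝓘(ℝ, V) ∞
  let : MeasurableSpace K := borel K
  have : BorelSpace K := ⟨rfl⟩
  let μ : Measure K := Measure.haar
  have hcont : ∀ x y : V, Continuous fun k : K => β (adjoint V k⁻¹ x) (adjoint V k⁻¹ y) := by
    intro x y
    have h1 := (continuous_adjoint (K := K) x).comp continuous_inv
    have h2 := (continuous_adjoint (K := K) y).comp continuous_inv
    let βc : V →L[ℝ] V →L[ℝ] ℝ := LinearMap.toContinuousLinearMap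
      ((LinearMap.toContinuousLinearMap : (V →ₗ[ℝ] ℝ) ≃ₗ[ℝ] (V →L[ℝ] ℝ)).toLinearMap ∘ₗ β)
    exact (βc.continuous.comp h1).clm_apply h2
  have hint : ∀ x y : V, Integrable
      (fun k : K => β (adjoint V k⁻¹ x) (adjoint V k⁻¹ y)) μ := fun x y =>
    (hcont x y).integrable_of_hasCompactSupport (HasCompactSupport.of_compactSpace _)
  refine ⟨LinearMap.mk₂ ℝ (fun x y => ∫ k, β (adjoint V k⁻¹ x) (adjoint V k⁻¹ y) ∂μ)
    (fun x y z => ?_) (fun c x y => ?_) (fun x y z => ?_) (fun c x y => ?_), ?_, ?_, ?_⟩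
  · rw [← integral_add (hint x z) (hint y z)]
    simp
  · rw [smul_eq_mul, ← integral_const_mul]
    simp
  · rw [← integral_add (hint x y) (hint x z)]
    simp
  · rw [smul_eq_mul, ← integral_const_mul]
    simp
  · intro x y
    simp only [LinearMap.mk₂_apply]
    exact integral_congr_ae (Filter.Eventually.of_forall fun k => hβs _ _)
  · intro x hx
    have hpos : ∀ k : K, 0 < β (adjoint V k⁻¹ x) (adjoint V k⁻¹ x) := by
      intro k
      refine hβp _ fun h => hx ?_
      rw [← adjoint_inv_adjoint k x, h, map_zero]
    simp only [LinearMap.mk₂_apply]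
    exact (hcont x x).integral_pos_of_hasCompactSupport_nonneg_nonzero
      (HasCompactSupport.of_compactSpace _) (fun k => (hpos k).le) (x := 1) (hpos 1).ne'
  · intro h x y
    simp only [LinearMap.mk₂_apply]
    rw [← integral_mul_left_eq_self (fun k : K => β (adjoint V k⁻¹ x) (adjoint V k⁻¹ y)) h⁻¹]
    refine integral_congr_ae (Filter.Eventually.of_forall fun k => ?_)
    simp only [mul_inv_rev, inv_inv, adjoint_mul]

/-- The infinitesimal version of `exists_adjoint_invariant_form`: `ad` is skew. -/
theorem exists_ad_invariant_form [CompactSpace K] :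
    ∃ Q : V →ₗ[ℝ] V →ₗ[ℝ] ℝ, (∀ x y, Q x y = Q y x) ∧ (∀ x, x ≠ 0 → 0 < Q x x) ∧
      ∀ x y z, Q (chartBracket K x y) z = -Q y (chartBracket K x z) := by
  obtain ⟨Q, hs, hp, hinv⟩ := exists_adjoint_invariant_form (V := V) (K := K)
  refine ⟨Q, hs, hp, fun x y z => ?_⟩
  let Qc : V →L[ℝ] V →L[ℝ] ℝ := LinearMap.toContinuousLinearMap
    ((LinearMap.toContinuousLinearMap : (V →ₗ[ℝ] ℝ) ≃ₗ[ℝ] (V →L[ℝ] ℝ)).toLinearMap ∘ₗ Q)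
  -- a curve of the adjoint action, in the chart around the unit
  have hd : ∀ Y : V, HasFDerivAt (fun u => adjoint V ((chartAt V (1 : K)).symm u) Y)
      (mfd V V (fun u => adjoint V ((chartAt V (1 : K)).symm u) Y) (oneChart V K))
      (oneChart V K) := by
    intro Y
    rw [mfd_eq_fderiv]
    refine DifferentiableAt.hasFDerivAt ?_
    exact ((mdifferentiableAt_adjoint Y _).comp _
      (mdifferentiableAt_chart_symm oneChart_mem)).differentiableAt
  have hv : ∀ Y X : V, mfd V V (fun u => adjoint V ((chartAt V (1 : K)).symm u) Y)
      (oneChart V K) X = chartBracket K X Y := by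
    intro Y X
    rw [mfd_comp_apply (g := fun k : K => adjoint V k Y) (mdifferentiableAt_adjoint Y _)
      (mdifferentiableAt_chart_symm oneChart_mem), mfd_chart_symm_oneChart, chart_symm_oneChart,
      ← (mdifferentiableAt_adjoint_one Y).2]
    rfl
  have h1 := ((Qc.hasFDerivAt.comp (oneChart V K) (hd y)).clm_apply (hd z))
  have h2 : HasFDerivAt (fun u => Qc (adjoint V ((chartAt V (1 : K)).symm u) y)
      (adjoint V ((chartAt V (1 : K)).symm u) z)) (0 : V →L[ℝ] ℝ) (oneChart V K) := by
    have : (fun u => Qc (adjoint V ((chartAt V (1 : K)).symm u) y)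
      (adjoint V ((chartAt V (1 : K)).symm u) z)) = fun _ => Q y z := funext fun u => hinv _ y z
    rw [this]
    exact hasFDerivAt_const _ _
  have h3 := congrArg (fun T : V →L[ℝ] ℝ => T x) (h1.unique h2)
  simp only [add_apply, ContinuousLinearMap.comp_apply, ContinuousLinearMap.flip_apply,
    zero_apply, hv, Function.comp_apply, chart_symm_oneChart, adjoint_one,
    ContinuousLinearMap.id_apply] at h3
  have h4 : ∀ a b, Qc a b = Q a b := fun a b => rfl
  rw [h4, h4] at h3
  linarith

end InvariantForm

/-! ### Vanishing derivatives and effectiveness -/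

section Constancy

open scoped Topology

variable {A : Type*} [NormedAddCommGroup A] [NormedSpace ℝ A]
  {B : Type*} [NormedAddCommGroup B] [NormedSpace ℝ B]
  {M : Type*} [TopologicalSpace M] [ChartedSpace A M] [IsManifold 𝓘(ℝ, A) ∞ M]
  {N : Type*} [TopologicalSpace N] [ChartedSpace B N] [IsManifold 𝓘(ℝ, B) ∞ N]

/-- A map between manifolds is locally constant where its derivative vanishes: restricted to a
ball in a chart, it stays in the source of one chart of the target, where the statement for vector
spaces applies. -/
theorem eventually_eq_of_mfd_eq_zero {f : M → N} {x : M}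
    (h : ∀ᶠ z in 𝓝 x, MDifferentiableAt 𝓘(ℝ, A) 𝓘(ℝ, B) f z ∧ mfd A B f z = 0) :
    ∀ᶠ z in 𝓝 x, f z = f x := by
  set φ := chartAt A x
  set χ := chartAt B (f x)
  have hf : ∀ᶠ z in 𝓝 x, f z ∈ χ.source :=
    h.self_of_nhds.1.continuousAt.eventually_mem
      (χ.open_source.mem_nhds (mem_chart_source B (f x)))
  have hxs : x ∈ φ.source := mem_chart_source A x
  have hxt : φ x ∈ φ.target := mem_chart_target A x
  have hc : Filter.Tendsto φ.symm (𝓝 (φ x)) (𝓝 x) := by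
    have := φ.continuousAt_symm hxt
    rwa [ContinuousAt, φ.left_inv hxs] at this
  obtain ⟨ε, hε, hb⟩ := Metric.eventually_nhds_iff_ball.1
    ((φ.open_target.eventually_mem hxt).and ((hc.eventually h).and (hc.eventually hf)))
  have hd : ∀ u ∈ Metric.ball (φ x) ε, MDifferentiableAt 𝓘(ℝ, A) 𝓘(ℝ, B)
      (fun u => f (φ.symm u)) u := fun u hu =>
    MDifferentiableAt.comp u (hb u hu).2.1.1 (mdifferentiableAt_chart_symm (hb u hu).1)
  have hconst : ∀ u ∈ Metric.ball (φ x) ε, χ (f (φ.symm u)) = χ (f (φ.symm (φ x))) := by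
    intro u hu
    refine Metric.isOpen_ball.is_const_of_fderiv_eq_zero (𝕜 := ℝ)
      (f := fun u => χ (f (φ.symm u)))
      (convex_ball (φ x) ε).isPreconnected (fun v hv => ?_) (fun v hv => ?_) hu
      (Metric.mem_ball_self hε)
    · exact (MDifferentiableAt.comp v (mdifferentiableAt_chart (hb v hv).2.2)
        (hd v hv)).differentiableAt.differentiableWithinAt
    · rw [← mfd_eq_fderiv, mfd_comp (f := fun u => f (φ.symm u))
        (mdifferentiableAt_chart (hb v hv).2.2) (hd v hv), mfd_comp (hb v hv).2.1.1
        (mdifferentiableAt_chart_symm (hb v hv).1), (hb v hv).2.1.2]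
      simp
  have hcφ : ContinuousAt φ x := φ.continuousAt hxs
  filter_upwards [hcφ.eventually_mem (Metric.ball_mem_nhds _ hε), φ.open_source.mem_nhds hxs, hf]
    with z hz hzs hzf
  have h1 := hconst _ hz
  rw [φ.left_inv hzs, φ.left_inv hxs] at h1
  exact χ.injOn hzf (mem_chart_source B (f x)) h1

theorem eq_of_mfd_eq_zero_of_isPreconnected {f : M → N} {s : Set M} (hs : IsOpen s)
    (hc : IsPreconnected s)
    (h : ∀ z ∈ s, MDifferentiableAt 𝓘(ℝ, A) 𝓘(ℝ, B) f z ∧ mfd A B f z = 0) {x y : M}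
    (hx : x ∈ s) (hy : y ∈ s) : f x = f y := by
  have : PreconnectedSpace s := isPreconnected_iff_preconnectedSpace.1 hc
  have hl : IsLocallyConstant (fun z : s => f z) := by
    rw [IsLocallyConstant.iff_eventually_eq]
    intro z
    have h1 : ∀ᶠ w in 𝓝 (z : M), f w = f z := by
      apply eventually_eq_of_mfd_eq_zero (A := A) (B := B)
      filter_upwards [hs.mem_nhds z.2] with w hw using h w hw
    exact continuous_subtype_val.continuousAt.eventually h1
  exact hl.apply_eq_of_preconnectedSpace ⟨x, hx⟩ ⟨y, hy⟩

theorem eq_of_mfd_eq_zero [PreconnectedSpace M] {f : M → N}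
    (hd : MDifferentiable 𝓘(ℝ, A) 𝓘(ℝ, B) f) (h : ∀ z, mfd A B f z = 0) (x y : M) :
    f x = f y :=
  eq_of_mfd_eq_zero_of_isPreconnected (A := A) (B := B) isOpen_univ isPreconnected_univ
    (fun z _ => ⟨hd z, h z⟩) (Set.mem_univ x) (Set.mem_univ y)

end Constancy

section Effective

open scoped Topology

variable {V : Type*} [NormedAddCommGroup V] [NormedSpace ℝ V] [CompleteSpace V]
  {K : Type*} [TopologicalSpace K] [ChartedSpace V K] [Group K] [LieGroup 𝓘(ℝ, V) ∞ K]
  {W : Type*} [NormedAddCommGroup W] [NormedSpace ℝ W]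
  {N : Type*} [TopologicalSpace N] [ChartedSpace W N] [IsManifold 𝓘(ℝ, W) ∞ N]

/-- If the fundamental vector field of `X ≠ 0` vanishes, then the local one-parameter group of
`X`, here an integral curve of a left invariant vector field, acts trivially. -/
theorem IsSmoothAction.infinite_kernel {act : K → N → N} (h : IsSmoothAction V W act) {X : V}
    (hX : X ≠ 0) (h0 : ∀ x, fundField V W act X x = 0) : {k : K | ∀ x, act k x = x}.Infinite := by
  have hv : ContMDiffAt 𝓘(ℝ, V) 𝓘(ℝ, V).tangent 1
      (fun g : K => (⟨g, mulInvariantVectorField (I := 𝓘(ℝ, V)) (G := K) X g⟩ :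
        TangentBundle 𝓘(ℝ, V) K)) 1 := by
    have := contMDiffAt_mulInvariantVectorField (I := 𝓘(ℝ, V)) (G := K) X (g := 1)
    refine this.of_le ?_
    rw [minSmoothness_of_isRCLikeNormedField]
    exact one_le_two
  obtain ⟨γ, hγ0, hγ⟩ := exists_isMIntegralCurveAt_of_contMDiffAt_boundaryless 0 hv
  obtain ⟨ε, hε, hb⟩ := Metric.eventually_nhds_iff_ball.1 hγ
  have hγd : ∀ t ∈ Metric.ball (0 : ℝ) ε, MDifferentiableAt 𝓘(ℝ, ℝ) 𝓘(ℝ, V) γ t :=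
    fun t ht => (hb t ht).mdifferentiableAt
  have hγv : ∀ t ∈ Metric.ball (0 : ℝ) ε, mfd ℝ V γ t =
      (1 : ℝ →L[ℝ] ℝ).smulRight (mfd V V (fun a : K => γ t * a) 1 X) :=
    fun t ht => (hb t ht).mfderiv
  -- by `mfd_orbit`, the orbits of the curve have velocity zero
  have hker : ∀ t ∈ Metric.ball (0 : ℝ) ε, γ t ∈ {k : K | ∀ x, act k x = x} := by
    intro t ht x
    have h1 : act (γ t) x = act (γ 0) x := by
      refine eq_of_mfd_eq_zero_of_isPreconnected (A := ℝ) (B := W) (f := fun t => act (γ t) x)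
        Metric.isOpen_ball (convex_ball (0 : ℝ) ε).isPreconnected (fun s hs => ⟨?_, ?_⟩) ht
        (Metric.mem_ball_self hε)
      · exact MDifferentiableAt.comp s (h.mdifferentiableAt_left x (γ s)) (hγd s hs)
      · rw [mfd_comp (h.mdifferentiableAt_left x (γ s)) (hγd s hs), hγv s hs]
        ext
        simp [h.mfd_orbit, h0]
    rw [h1, hγ0, h.one_act]
  -- the curve has the velocity `X ≠ 0` at the unit, so that it is not contained in a finite set
  intro hfin
  have hder : HasDerivAt (fun t => chartAt V (1 : K) (γ t)) X 0 := by
    have hd0 := hγd 0 (Metric.mem_ball_self hε)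
    have hc : MDifferentiableAt 𝓘(ℝ, V) 𝓘(ℝ, V) (chartAt V (1 : K)) (γ 0) := by
      rw [hγ0]
      exact mdifferentiableAt_chart (mem_chart_source V 1)
    have h1 : DifferentiableAt ℝ (fun t => chartAt V (1 : K) (γ t)) 0 :=
      (MDifferentiableAt.comp (0 : ℝ) hc hd0).differentiableAt
    have h2 : fderiv ℝ (fun t => chartAt V (1 : K) (γ t)) 0 1 = X := by
      rw [← mfd_eq_fderiv, mfd_comp_apply hc hd0, hγv 0 (Metric.mem_ball_self hε), hγ0,
        mfd_chart_self]
      simp [mfd_id]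
    have h3 := h1.hasDerivAt
    rwa [← fderiv_apply_one_eq_deriv, h2] at h3
  have hne : ∀ᶠ t in 𝓝[≠] (0 : ℝ), ∀ k ∈ {k : K | ∀ x, act k x = x},
      chartAt V (1 : K) (γ t) ≠ chartAt V (1 : K) k :=
    (Filter.eventually_all_finite hfin).2 fun k _ => hder.eventually_ne hX
  have hin : ∀ᶠ t in 𝓝[≠] (0 : ℝ), t ∈ Metric.ball (0 : ℝ) ε :=
    nhdsWithin_le_nhds (Metric.ball_mem_nhds _ hε)
  obtain ⟨t, ht1, ht2⟩ := (hne.and hin).exists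
  exact ht1 (γ t) (hker t ht2) rfl

end Effective

/-! ### Maps into an injectively immersed Lie group -/

section InitialProperty

open scoped Topology

variable {V : Type*} [NormedAddCommGroup V] [NormedSpace ℝ V] [FiniteDimensional ℝ V]
  {K : Type*} [TopologicalSpace K] [ChartedSpace V K] [Group K] [LieGroup 𝓘(ℝ, V) ∞ K]
  {W : Type*} [NormedAddCommGroup W] [NormedSpace ℝ W]
  {L : Type*} [TopologicalSpace L] [ChartedSpace W L] [Group L] [LieGroup 𝓘(ℝ, W) ∞ L]

/-- An injective homomorphism of Lie groups is an immersion: a vector in the kernel of its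
derivative generates a local one-parameter group in its kernel. -/
theorem mfd_injective {c : K →* L} (hc : ContMDiff 𝓘(ℝ, V) 𝓘(ℝ, W) ∞ c)
    (hi : Function.Injective c) : Function.Injective (mfd V W c 1) := by
  have : CompleteSpace V := FiniteDimensional.complete ℝ V
  rw [injective_iff_map_eq_zero]
  intro X hX
  by_contra hne
  refine (isSmoothAction_hom hc).infinite_kernel hne (fun x => ?_) ?_
  · rw [fundField_hom hc, hX]
    exact map_zero _
  · refine (Set.finite_singleton (1 : K)).subset fun k hk => hi ?_
    simpa using hk 1

/-- Smoothness of a continuous map into `K` can be checked after an injective homomorphism from `K`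
to a Lie group. -/
theorem contMDiff_of_comp [FiniteDimensional ℝ W] {c : K →* L} (hc : ContMDiff 𝓘(ℝ, V) 𝓘(ℝ, W) ∞ c)
    (hi : Function.Injective c) {E' H' P : Type*} [NormedAddCommGroup E'] [NormedSpace ℝ E']
    [TopologicalSpace H'] {I : ModelWithCorners ℝ E' H'} [TopologicalSpace P] [ChartedSpace H' P]
    {f : P → K} (hf : Continuous f) (hcf : ContMDiff I 𝓘(ℝ, W) ∞ fun p => c (f p)) :
    ContMDiff I 𝓘(ℝ, V) ∞ f := by
  have : CompleteSpace V := FiniteDimensional.complete ℝ V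
  have : IsTopologicalGroup K := topologicalGroup_of_lieGroup 𝓘(ℝ, V) ∞
  have : IsTopologicalGroup L := topologicalGroup_of_lieGroup 𝓘(ℝ, W) ∞
  intro p
  set e := oneChart V K
  obtain ⟨ρ, hρ⟩ : ∃ ρ : W →L[ℝ] V, ∀ X, ρ (mfd V W c 1 X) = X := by
    obtain ⟨ρ, hρ⟩ := ContinuousLinearMap.HasLeftInverse.of_injective_of_finiteDimensional
      (mfd_injective hc hi)
    exact ⟨ρ, hρ⟩
  -- a left inverse of the derivative of `c` turns `c` into a local diffeomorphism
  let J : V → V := fun u => ρ (chartAt W (1 : L) (c ((chartAt V (1 : K)).symm u)))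
  have hsymm : ContMDiffAt 𝓘(ℝ, V) 𝓘(ℝ, V) ∞ (chartAt V (1 : K)).symm e :=
    contMDiffAt_chart_symm oneChart_mem
  have hc1 : ContMDiffAt 𝓘(ℝ, V) 𝓘(ℝ, W) ∞ (fun u => c ((chartAt V (1 : K)).symm u)) e :=
    hc.contMDiffAt.comp e hsymm
  have hce : c ((chartAt V (1 : K)).symm e) = 1 := by simp [e]
  have hch : ContMDiffAt 𝓘(ℝ, W) 𝓘(ℝ, W) ∞ (chartAt W (1 : L))
      (c ((chartAt V (1 : K)).symm e)) := by
    rw [hce]; exact contMDiffAt_chart (mem_chart_source W 1)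
  have hJm : ContMDiffAt 𝓘(ℝ, V) 𝓘(ℝ, W) ∞
      (fun u => chartAt W (1 : L) (c ((chartAt V (1 : K)).symm u))) e :=
    ContMDiffAt.comp e (g := chartAt W (1 : L)) hch hc1
  have hJ : ContDiffAt ℝ ∞ J e := ρ.contDiff.contDiffAt.comp e hJm.contDiffAt
  have hJ' : HasFDerivAt J ((ContinuousLinearEquiv.refl ℝ V : V ≃L[ℝ] V) : V →L[ℝ] V) e := by
    have h1 : HasFDerivAt (𝕜 := ℝ) J _ e :=
      ρ.hasFDerivAt.comp e (hJm.contDiffAt.differentiableAt (by simp)).hasFDerivAt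
    convert h1
    ext X
    have h2 := mfd_comp_apply (f := fun u => c ((chartAt V (1 : K)).symm u))
      (hch.mdifferentiableAt (by simp))
      (hc1.mdifferentiableAt (by simp)) X
    have h3 := mfd_comp_apply (hc.mdifferentiable (by simp) ((chartAt V (1 : K)).symm e))
      (hsymm.mdifferentiableAt (by simp)) X
    rw [ContinuousLinearMap.comp_apply, ← mfd_eq_fderiv, h2, h3, hce, mfd_chart_self,
      mfd_chart_symm_oneChart, chart_symm_oneChart]
    exact (hρ X).symm
  let j : V → V := hJ.localInverse hJ' (by simp)
  have hj : ContDiffAt ℝ ∞ j (J e) := hJ.to_localInverse hJ' (by simp)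
  have hje : j (J e) = e := hJ.localInverse_apply_image hJ' (by simp)
  have hleft : ∀ᶠ u in 𝓝 e, j (J u) = u :=
    (hJ.hasStrictFDerivAt' hJ' (by simp)).eventually_left_inverse
  let r : P → W := fun q => chartAt W (1 : L) ((c (f p))⁻¹ * c (f q))
  have hr1 : (c (f p))⁻¹ * c (f p) = 1 := inv_mul_cancel _
  have hr : ContMDiffAt I 𝓘(ℝ, W) ∞ r p := by
    refine ContMDiffAt.comp p (g := chartAt W (1 : L)) ?_ (contMDiffAt_const.mul hcf.contMDiffAt)
    rw [hr1]; exact contMDiffAt_chart (mem_chart_source W 1)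
  have hrp : ρ (r p) = J e := by simp only [r, J, hr1, hce]
  have hg : Filter.Tendsto (fun q => (f p)⁻¹ * f q) (𝓝 p) (𝓝 1) := by
    have : Continuous fun q => (f p)⁻¹ * f q := continuous_const.mul hf
    simpa using this.tendsto p
  have hψ := (chartAt V (1 : K)).continuousAt (mem_chart_source V 1)
  -- after a translation to the unit, `f` is recovered from `c ∘ f` by the local inverse `j`
  have heq : f =ᶠ[𝓝 p] fun q => f p * (chartAt V (1 : K)).symm (j (ρ (r q))) := by
    filter_upwards [hg.eventually ((chartAt V (1 : K)).open_source.mem_nhds (mem_chart_source V 1)),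
      hg.eventually (hψ.eventually hleft)] with q hq1 hq2
    have : ρ (r q) = J (chartAt V (1 : K) ((f p)⁻¹ * f q)) := by
      simp only [J, r, (chartAt V (1 : K)).left_inv hq1, map_mul, map_inv]
    rw [this, hq2, (chartAt V (1 : K)).left_inv hq1]
    simp
  refine ContMDiffAt.congr_of_eventuallyEq (contMDiffAt_const.mul ?_) heq
  have h1 : ContMDiffAt I 𝓘(ℝ, V) ∞ (fun q => j (ρ (r q))) p := by
    refine ContMDiffAt.comp p (g := fun w => j (ρ w)) ?_ hr
    refine ContDiffAt.contMDiffAt (ContDiffAt.comp _ ?_ ρ.contDiff.contDiffAt)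
    rwa [hrp]
  refine ContMDiffAt.comp p (g := (chartAt V (1 : K)).symm) ?_ h1
  rw [hrp, hje]
  exact hsymm

end InitialProperty

/-! ### Rigidity of compact groups whose Lie algebra is abelian -/

section Rigidity

open scoped Topology

theorem mfd_comp₂ {A : Type*} [NormedAddCommGroup A] [NormedSpace ℝ A]
    {B : Type*} [NormedAddCommGroup B] [NormedSpace ℝ B]
    {C : Type*} [NormedAddCommGroup C] [NormedSpace ℝ C]
    {D : Type*} [NormedAddCommGroup D] [NormedSpace ℝ D]
    {M : Type*} [TopologicalSpace M] [ChartedSpace A M]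
    {N : Type*} [TopologicalSpace N] [ChartedSpace B N]
    {P : Type*} [TopologicalSpace P] [ChartedSpace C P]
    {R : Type*} [TopologicalSpace R] [ChartedSpace D R]
    {f : M → N → P} {p : R → M} {q : R → N} {x : R}
    (hf : MDifferentiableAt (𝓘(ℝ, A).prod 𝓘(ℝ, B)) 𝓘(ℝ, C) (Function.uncurry f) (p x, q x))
    (hp : MDifferentiableAt 𝓘(ℝ, D) 𝓘(ℝ, A) p x) (hq : MDifferentiableAt 𝓘(ℝ, D) 𝓘(ℝ, B) q x)
    (X : D) :
    mfd D C (fun r => f (p r) (q r)) x X =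
      mfd A C (fun a => f a (q x)) (p x) (mfd D A p x X) +
        mfd B C (fun b => f (p x) b) (q x) (mfd D B q x X) := by
  have h1 := mfderiv_comp x (g := Function.uncurry f) (f := fun r => (p r, q r)) hf (hp.prodMk hq)
  have h2 := congrArg (fun T : D →L[ℝ] C => T X) h1
  rw [mfderiv_prodMk hp hq] at h2
  exact h2.trans (mfderiv_prod_eq_add_apply hf)

variable {V : Type*} [NormedAddCommGroup V] [NormedSpace ℝ V]
  {K : Type*} [TopologicalSpace K] [ChartedSpace V K] [Group K] [LieGroup 𝓘(ℝ, V) ∞ K]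
  {W : Type*} [NormedAddCommGroup W] [NormedSpace ℝ W]
  {L : Type*} [TopologicalSpace L] [ChartedSpace W L] [Group L]

/-- The product rule at the unit, where left and right translations are trivial. -/
theorem mfd_mul_one_one {p q : L → K} (hp : MDifferentiableAt 𝓘(ℝ, W) 𝓘(ℝ, V) p 1)
    (hq : MDifferentiableAt 𝓘(ℝ, W) 𝓘(ℝ, V) q 1) (hp1 : p 1 = 1) (hq1 : q 1 = 1) (Z : W) :
    mfd W V (fun a => p a * q a) 1 Z = mfd W V p 1 Z + mfd W V q 1 Z := by
  rw [mfd_comp₂ (f := fun a b : K => a * b) (contMDiff_mul_uncurry.mdifferentiable (by simp) _)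
    hp hq, hp1, hq1]
  simp [mfd_id]

/-- The velocity of the displacement `a ↦ (a • k) * k⁻¹` of an action by automorphisms. -/
noncomputable def displacement (act : L → K → K) (Z : W) (k : K) : V :=
  mfd W V (fun a => act a k * k⁻¹) 1 Z

variable {act : L → K → K}

theorem contMDiff_displacement (h : IsSmoothAction W V act) :
    ContMDiff (𝓘(ℝ, W).prod 𝓘(ℝ, V)) 𝓘(ℝ, V) ∞ (Function.uncurry fun a k => act a k * k⁻¹) :=
  h.contMDiff.mul contMDiff_snd.inv

/-- In general the displacement is a cocycle, `η (k * l) = η k + Ad k (η l)`. -/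
theorem displacement_mul (h : IsSmoothAction W V act)
    (hmul : ∀ a k l, act a (k * l) = act a k * act a l) (Z : W) {k : K}
    (hk : adjoint V k = ContinuousLinearMap.id ℝ V) (l : K) :
    displacement (V := V) act Z (k * l) =
      displacement (V := V) act Z k + displacement (V := V) act Z l := by
  have hd : ∀ k : K, MDifferentiableAt 𝓘(ℝ, W) 𝓘(ℝ, V) (fun a => act a k * k⁻¹) 1 := fun k =>
    (contMDiffAt_left (contMDiff_displacement h).contMDiffAt).mdifferentiableAt (by simp)
  have h0 : ∀ k : K, act 1 k * k⁻¹ = 1 := fun k => by simp [h.one_act]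
  have hc : MDifferentiableAt 𝓘(ℝ, V) 𝓘(ℝ, V) (fun x : K => k * x * k⁻¹) (act 1 l * l⁻¹) :=
    mdifferentiableAt_conj k _
  have h1 := mfd_mul_one_one (hd k)
    (MDifferentiableAt.comp (1 : L) (g := fun x : K => k * x * k⁻¹) hc (hd l)) (h0 k)
    (by simp [h.one_act]) Z
  have h2 := mfd_comp_apply (g := fun x : K => k * x * k⁻¹) (f := fun a => act a l * l⁻¹) hc
    (hd l) Z
  have h3 : mfd V V (fun x : K => k * x * k⁻¹) (act 1 l * l⁻¹) = ContinuousLinearMap.id ℝ V := by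
    rw [h0]; exact hk
  rw [h3] at h2
  have h4 : (fun a => act a (k * l) * (k * l)⁻¹) =
      fun a => (act a k * k⁻¹) * (k * (act a l * l⁻¹) * k⁻¹) := by
    funext a
    rw [hmul]
    group
  rw [displacement, h4]
  refine h1.trans ?_
  congr 1

/-- The kernel of the adjoint representation is invariant under automorphisms. -/
theorem adjoint_act (h : IsSmoothAction W V act)
    (hmul : ∀ a k l, act a (k * l) = act a k * act a l) {k : K}
    (hk : adjoint V k = ContinuousLinearMap.id ℝ V) (a : L) :
    adjoint V (act a k) = ContinuousLinearMap.id ℝ V := by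
  have h1 : ∀ a : L, act a 1 = 1 := fun a => by simpa using hmul a 1 1
  have hinv : ∀ (a : L) (k : K), act a k⁻¹ = (act a k)⁻¹ := fun a k => by
    rw [eq_inv_iff_mul_eq_one, ← hmul, inv_mul_cancel, h1]
  have hd : ∀ (a : L) (x : K), MDifferentiableAt 𝓘(ℝ, V) 𝓘(ℝ, V) (act a) x :=
    fun a x => h.mdifferentiableAt_right a x
  have hcomp : ∀ (a b : L) (X : V),
      mfd V V (act (a * b)) 1 X = mfd V V (act a) 1 (mfd V V (act b) 1 X) := by
    intro a b X
    have := mfd_comp_apply (g := act a) (f := act b) (x := (1 : K)) (hd a _) (hd b 1) X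
    rw [h1] at this
    rw [← this]
    congr 2
    funext x
    exact h.mul_act a b x
  have hid : mfd V V (act 1) (1 : K) = ContinuousLinearMap.id ℝ V := by
    rw [← mfd_id (1 : K)]
    congr 1
    funext x
    exact h.one_act x
  have hconj : ∀ X, mfd V V (act a) 1 (adjoint V k X) =
      adjoint V (act a k) (mfd V V (act a) 1 X) := by
    intro X
    have e1 := mfd_comp_apply (g := act a) (f := fun x : K => k * x * k⁻¹) (x := (1 : K))
      (hd a _) (mdifferentiableAt_conj k 1) X
    have e2 := mfd_comp_apply (g := fun x : K => act a k * x * (act a k)⁻¹) (f := act a)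
      (x := (1 : K)) (mdifferentiableAt_conj (V := V) _ _) (hd a 1) X
    simp only [mul_one, mul_inv_cancel, h1] at e1 e2
    rw [adjoint, adjoint, ← e1, ← e2]
    simp only [hmul, hinv]
  ext X
  have h2 := hconj (mfd V V (act a⁻¹) 1 X)
  rwa [hk, ContinuousLinearMap.id_apply, ← hcomp, mul_inv_cancel, hid, eq_comm] at h2

variable [LieGroup 𝓘(ℝ, W) ∞ L]

theorem continuous_displacement (h : IsSmoothAction W V act) (Z : W) :
    Continuous (displacement (V := V) act Z) := by
  rw [continuous_iff_continuousAt]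
  intro k₀
  set n : W × V → V := inCharts (1 : L) k₀ (1 : K) (fun a k => act a k * k⁻¹) with hn
  have hs : ∀ k : K, act 1 k * k⁻¹ ∈ (chartAt V (1 : K)).source := fun k => by simp [h.one_act]
  have heq : displacement (V := V) act Z =ᶠ[𝓝 k₀]
      fun k => fderiv ℝ n (oneChart W L, chartAt V k₀ k) (Z, 0) := by
    filter_upwards [(chartAt V k₀).open_source.mem_nhds (mem_chart_source V k₀)] with k hk
    rw [hn, fderiv_inCharts_left oneChart_mem ((chartAt V k₀).map_source hk)
      (contMDiff_displacement h).contMDiffAt (by simpa using hs _), mfd_chart_symm_oneChart,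
      (chartAt V k₀).left_inv hk]
    simp [h.one_act, mfd_chart_self, displacement]
  refine ContinuousAt.congr ?_ heq.symm
  have h1 : ContDiffAt ℝ ∞ n (oneChart W L, chartAt V k₀ k₀) :=
    contDiffAt_inCharts oneChart_mem (mem_chart_target V k₀)
      (contMDiff_displacement h).contMDiffAt (by simpa using hs _)
  have h2 : ContinuousAt (fderiv ℝ n) (oneChart W L, chartAt V k₀ k₀) :=
    (h1.fderiv_right (m := ∞) (by simp)).continuousAt
  have h3 : ContinuousAt (fun k => (oneChart W L, chartAt V k₀ k)) k₀ :=
    continuousAt_const.prodMk ((chartAt V k₀).continuousAt (mem_chart_source V k₀))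
  exact (ContinuousAt.comp (f := fun k => (oneChart W L, chartAt V k₀ k)) h2 h3).clm_apply
    continuousAt_const

/-- On a compact group, a displacement which is additive on the powers of `k` vanishes at `k`,
as it is bounded. -/
theorem displacement_eq_zero [CompactSpace K] (h : IsSmoothAction W V act)
    (hmul : ∀ a k l, act a (k * l) = act a k * act a l) (Z : W) {k : K}
    (hk : adjoint V k = ContinuousLinearMap.id ℝ V) : displacement (V := V) act Z k = 0 := by
  have hpow : ∀ n : ℕ, displacement (V := V) act Z (k ^ n * k) =
      (n + 1 : ℝ) • displacement (V := V) act Z k := by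
    intro n
    induction n with
    | zero => simp
    | succ n ih =>
      rw [pow_succ', mul_assoc, displacement_mul h hmul Z hk, ih]
      push_cast
      module
  obtain ⟨C, hC⟩ := isCompact_univ.exists_bound_of_continuousOn
    (continuous_displacement h Z).continuousOn
  by_contra hne
  have hpos : 0 < ‖displacement (V := V) act Z k‖ := norm_pos_iff.2 hne
  obtain ⟨n, hn⟩ := exists_nat_gt (C / ‖displacement (V := V) act Z k‖)
  have h1 := hC (k ^ n * k) (Set.mem_univ _)
  rw [hpow, norm_smul, Real.norm_of_nonneg (by positivity)] at h1
  rw [div_lt_iff₀ hpos] at hn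
  nlinarith

/-- A connected group acting by automorphisms on a compact group `K` fixes the kernel of the adjoint
representation of `K` pointwise. -/
theorem act_eq_self [CompactSpace K] [PreconnectedSpace L] (h : IsSmoothAction W V act)
    (hmul : ∀ a k l, act a (k * l) = act a k * act a l) {k : K}
    (hk : adjoint V k = ContinuousLinearMap.id ℝ V) (a : L) : act a k = k := by
  have hone : ∀ k : K, adjoint V k = ContinuousLinearMap.id ℝ V →
      mfd W V (fun a => act a k) 1 = 0 := by
    intro k hk
    ext Z
    have h1 : (fun a => act a k) = fun a => act a k * k⁻¹ * k := by simp
    have hd : MDifferentiableAt 𝓘(ℝ, W) 𝓘(ℝ, V) (fun a => act a k * k⁻¹) 1 :=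
      (contMDiffAt_left (contMDiff_displacement h).contMDiffAt).mdifferentiableAt (by simp)
    have h2 : MDifferentiableAt 𝓘(ℝ, V) 𝓘(ℝ, V) (fun x : K => x * k) (act 1 k * k⁻¹) :=
      (contMDiff_mul_right (I := 𝓘(ℝ, V)) (n := ∞) (a := k)).mdifferentiable (by simp) _
    rw [h1, mfd_comp_apply (g := fun x : K => x * k) (f := fun a => act a k * k⁻¹) h2 hd]
    have h3 : mfd W V (fun a => act a k * k⁻¹) 1 Z = 0 := displacement_eq_zero h hmul Z hk
    rw [h3]
    simp
  -- other points of `L` are moved to the unit, as `act b k` satisfies the same hypothesis as `k`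
  have hall : ∀ b : L, mfd W V (fun a => act a k) b = 0 := by
    intro b
    have h1 : (fun a => act a k) = fun a => act (a * b⁻¹) (act b k) := by
      funext a
      rw [← h.mul_act]
      simp
    have h2 : MDifferentiableAt 𝓘(ℝ, W) 𝓘(ℝ, W) (fun a : L => a * b⁻¹) b :=
      (contMDiff_mul_right (I := 𝓘(ℝ, W)) (n := ∞) (a := b⁻¹)).mdifferentiable (by simp) _
    rw [h1, mfd_comp (g := fun a => act a (act b k)) (h.mdifferentiableAt_left _ _) h2,
      mul_inv_cancel, hone _ (adjoint_act h hmul hk b)]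
    simp
  have := eq_of_mfd_eq_zero (A := W) (B := V) (fun b => h.mdifferentiableAt_left k b) hall a 1
  rwa [h.one_act] at this

theorem eventually_adjoint_eq_id [FiniteDimensional ℝ V]
    (h0 : ∀ X Y : V, chartBracket K X Y = 0) :
    ∀ᶠ k in 𝓝 (1 : K), adjoint V k = ContinuousLinearMap.id ℝ V := by
  have h1 : ∀ Y : V, ∀ᶠ k in 𝓝 (1 : K), adjoint V k Y = Y := by
    intro Y
    have := eventually_eq_of_mfd_eq_zero (A := V) (B := V) (f := fun k : K => adjoint V k Y)
      (x := 1) (Filter.Eventually.of_forall fun k => ⟨mdifferentiableAt_adjoint Y k, by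
        ext X
        rw [mfd_adjoint, h0]
        simp⟩)
    simpa only [adjoint_one, ContinuousLinearMap.id_apply] using this
  filter_upwards [Filter.eventually_all.2 fun i => h1 (Module.finBasis ℝ V i)] with k hk
  have : (adjoint V k : V →ₗ[ℝ] V) = LinearMap.id := (Module.finBasis ℝ V).ext hk
  ext X
  exact congrArg (fun T : V →ₗ[ℝ] V => T X) this

/-- A compact Lie group `K` whose Lie algebra is abelian is abelian, provided that its conjugations
are among the automorphisms of `K` given by the action of a connected Lie group. -/
theorem mul_comm_of_chartBracket_eq_zero [FiniteDimensional ℝ V] [CompactSpace K]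
    [PreconnectedSpace L] (h : IsSmoothAction W V act)
    (hmul : ∀ a k l, act a (k * l) = act a k * act a l)
    (hconj : ∀ k : K, ∃ a : L, ∀ x, act a x = k * x * k⁻¹)
    (h0 : ∀ X Y : V, chartBracket K X Y = 0) (k l : K) : k * l = l * k := by
  have hcomm : ∀ k l : K, adjoint V l = ContinuousLinearMap.id ℝ V → k * l = l * k := by
    intro k l hl
    obtain ⟨a, ha⟩ := hconj k
    have := act_eq_self h hmul hl a
    rwa [ha, mul_inv_eq_iff_eq_mul] at this
  -- elements near the unit are central, so that the conjugation by `l` is trivial near the unit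
  refine hcomm k l ?_
  rw [adjoint, ← mfd_id (1 : K)]
  refine mfd_congr ?_
  filter_upwards [eventually_adjoint_eq_id h0] with x hx
  rw [hcomm l x hx]
  simp

end Rigidity

/-! ### Conjugations of a normal subgroup -/

section Conjugation

/-- The derivative at the unit of a smooth automorphism is an automorphism of the Lie algebra. -/
theorem exists_lieEquiv_of_mulEquiv {V : Type*} [NormedAddCommGroup V] [NormedSpace ℝ V]
    [CompleteSpace V] {K : Type*} [TopologicalSpace K] [ChartedSpace V K] [Group K]
    [LieGroup 𝓘(ℝ, V) ∞ K] (c : K ≃* K) (hc : ContMDiff 𝓘(ℝ, V) 𝓘(ℝ, V) ∞ c)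
    (hc' : ContMDiff 𝓘(ℝ, V) 𝓘(ℝ, V) ∞ c.symm) :
    ∃ e : GroupLieAlgebra 𝓘(ℝ, V) K ≃ₗ⁅ℝ⁆ GroupLieAlgebra 𝓘(ℝ, V) K,
      ∀ X, e X = (mfd V V c 1 (X : V) : V) := by
  have key : ∀ c : K ≃* K, ContMDiff 𝓘(ℝ, V) 𝓘(ℝ, V) ∞ c →
      ContMDiff 𝓘(ℝ, V) 𝓘(ℝ, V) ∞ c.symm → ∀ X : V,
      mfd V V c.symm 1 (mfd V V c 1 X) = X := by
    intro c hc hc' X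
    have := mfd_comp_apply (g := c.symm) (f := c) (x := (1 : K))
      (hc'.mdifferentiable (by simp) _) (hc.mdifferentiable (by simp) 1) X
    rw [map_one] at this
    rw [← this]
    simp [mfd_id]
  let e₀ : V ≃ₗ[ℝ] V := LinearEquiv.ofLinearMap (mfd V V c 1 : V →ₗ[ℝ] V)
    (mfd V V c.symm 1 : V →ₗ[ℝ] V) (LinearMap.ext fun X => key c.symm hc' hc X)
    (LinearMap.ext fun X => key c hc hc' X)
  refine ⟨{ (e₀ : GroupLieAlgebra 𝓘(ℝ, V) K ≃ₗ[ℝ] GroupLieAlgebra 𝓘(ℝ, V) K) with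
    map_lie' := fun {X Y} => ?_ }, fun X => rfl⟩
  have := mfd_chartBracket (c := c.toMonoidHom) hc X Y
  rw [lie_eq_chartBracket X Y]
  refine Eq.trans this ?_
  exact (lie_eq_chartBracket (e₀ X) (e₀ Y)).symm

/-- The family of `exists_invariant_family` for the Lie algebra of a compact group, where the
automorphisms are those induced by smooth automorphisms of the group. -/
theorem exists_frame {V : Type*} [NormedAddCommGroup V] [NormedSpace ℝ V]
    [FiniteDimensional ℝ V] {K : Type*} [TopologicalSpace K] [ChartedSpace V K] [Group K]
    [LieGroup 𝓘(ℝ, V) ∞ K] [CompactSpace K] (hna : ∃ X Y : V, chartBracket K X Y ≠ 0) :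
    ∃ (n : ℕ) (X : Fin n → V) (a : Fin n → Fin n → Fin n → ℝ),
      (∀ l, X l = ∑ i, ∑ j, a l i j • chartBracket K (X i) (X j)) ∧ (∃ i, X i ≠ 0) ∧
      ∀ c : K ≃* K, ContMDiff 𝓘(ℝ, V) 𝓘(ℝ, V) ∞ c → ContMDiff 𝓘(ℝ, V) 𝓘(ℝ, V) ∞ c.symm →
        ∀ β : V →L[ℝ] V →L[ℝ] ℝ,
          ∑ i, β (mfd V V c 1 (X i)) (mfd V V c 1 (X i)) = ∑ i, β (X i) (X i) := by
  have : CompleteSpace V := FiniteDimensional.complete ℝ V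
  have : FiniteDimensional ℝ (GroupLieAlgebra 𝓘(ℝ, V) K) :=
    inferInstanceAs (FiniteDimensional ℝ V)
  obtain ⟨Q, hs, hp, hinv⟩ := exists_ad_invariant_form (V := V) (K := K)
  have hlie : ∀ x y : GroupLieAlgebra 𝓘(ℝ, V) K, ⁅x, y⁆ = (chartBracket K (x : V) (y : V) : V) :=
    lie_eq_chartBracket
  obtain ⟨n, X, a, hbr, hne, hsum⟩ :=
    exists_invariant_family (k := GroupLieAlgebra 𝓘(ℝ, V) K) Q hs hp
      (fun x y z => by rw [hlie, hlie]; exact hinv x y z)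
      (by obtain ⟨x, y, h⟩ := hna; exact ⟨x, y, fun h0 => h ((hlie x y).symm.trans h0)⟩)
  refine ⟨n, X, a, fun l => ?_, hne, fun c hc hc' β => ?_⟩
  · refine (hbr l).trans (Finset.sum_congr rfl fun i _ => Finset.sum_congr rfl fun j _ => ?_)
    exact congrArg (fun z : V => a l i j • z) (hlie (X i) (X j))
  · obtain ⟨e, he⟩ := exists_lieEquiv_of_mulEquiv c hc hc'
    refine Eq.trans (Finset.sum_congr rfl fun i _ => ?_) (hsum e β.toLinearMap₁₂)
    rw [he]
    rfl

variable {EG : Type*} [NormedAddCommGroup EG] [NormedSpace ℝ EG] [FiniteDimensional ℝ EG]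
  {G : Type*} [TopologicalSpace G] [ChartedSpace EG G] [Group G] [LieGroup 𝓘(ℝ, EG) ∞ G]
  {K : Subgroup G} [K.Normal]
  {EK : Type*} [NormedAddCommGroup EK] [NormedSpace ℝ EK] [FiniteDimensional ℝ EK]
  [ChartedSpace EK K] [LieGroup 𝓘(ℝ, EK) ∞ K]

/-- The conjugation action on an immersed normal subgroup is smooth for the smooth structure of the
subgroup. -/
theorem isSmoothAction_conjNormal (hK : ContMDiff 𝓘(ℝ, EK) 𝓘(ℝ, EG) ∞ (K.subtype : K → G)) :
    IsSmoothAction EG EK (fun (a : G) (k : K) => MulAut.conjNormal a k) where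
  one_act k := by simp
  mul_act a b k := by simp
  contMDiff := by
    have : IsTopologicalGroup G := topologicalGroup_of_lieGroup 𝓘(ℝ, EG) ∞
    refine contMDiff_of_comp hK K.subtype_injective ?_ ?_
    · refine Continuous.subtype_mk (f := fun p : G × K => p.1 * p.2 * p.1⁻¹) ?_ _
      fun_prop
    · exact (contMDiff_fst.mul (hK.comp contMDiff_snd)).mul contMDiff_fst.inv

theorem contMDiff_conjNormal (hK : ContMDiff 𝓘(ℝ, EK) 𝓘(ℝ, EG) ∞ (K.subtype : K → G))
    (a : G) : ContMDiff 𝓘(ℝ, EK) 𝓘(ℝ, EK) ∞ (MulAut.conjNormal a : K ≃* K) ∧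
      ContMDiff 𝓘(ℝ, EK) 𝓘(ℝ, EK) ∞ (MulAut.conjNormal a : K ≃* K).symm := by
  have h := isSmoothAction_conjNormal hK
  refine ⟨h.contMDiff_right a, ?_⟩
  have := h.contMDiff_right a⁻¹
  simp only [map_inv] at this
  exact this

end Conjugation

/-! ### Riemannian metrics in charts -/

section MetricInChart

open scoped Topology

variable {E : Type*} [NormedAddCommGroup E] [NormedSpace ℝ E]
  {M : Type*} [TopologicalSpace M] [ChartedSpace E M] [IsManifold 𝓘(ℝ, E) ∞ M]

/-- A metric at a point, as a bilinear form on the model space, with which the tangent spaces are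
identified as in `mfd`. -/
def metricAt (g : Metric E M) (x : M) : E →L[ℝ] E →L[ℝ] ℝ := g.inner x

theorem metricAt_symm (g : Metric E M) (x : M) (v w : E) : metricAt g x v w = metricAt g x w v :=
  g.symm x v w

theorem metricAt_pos (g : Metric E M) (x : M) {v : E} (hv : v ≠ 0) : 0 < metricAt g x v v :=
  g.pos x v hv

theorem metricInChart_apply (g : Metric E M) (x : M) (y v w : E) :
    metricInChart g x y v w = metricAt g ((chartAt E x).symm y)
      (mfd E E (chartAt E x).symm y v) (mfd E E (chartAt E x).symm y w) := rfl

theorem metricInChart_symm (g : Metric E M) (x : M) (y v w : E) :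
    metricInChart g x y v w = metricInChart g x y w v := by
  rw [metricInChart_apply, metricInChart_apply, metricAt_symm]

theorem metricInChart_pos (g : Metric E M) {x : M} {y : E} (hy : y ∈ (chartAt E x).target) {v : E}
    (hv : v ≠ 0) : 0 < metricInChart g x y v v := by
  rw [metricInChart_apply]
  refine metricAt_pos g _ fun h => hv ?_
  have := mfd_chart_comp_symm hy v
  rwa [h, map_zero, eq_comm] at this

theorem metricInChart_chart (g : Metric E M) {x y : M} (hy : y ∈ (chartAt E x).source) (v w : E) :
    metricInChart g x (chartAt E x y) (mfd E E (chartAt E x) y v) (mfd E E (chartAt E x) y w) =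
      metricAt g y v w := by
  rw [metricInChart_apply, mfd_chart_symm_comp hy, mfd_chart_symm_comp hy,
    (chartAt E x).left_inv hy]

/-- The coordinate vector fields of a chart are smooth sections of the tangent bundle. -/
theorem contMDiffAt_chart_symm_section {x : M} {y : E} (hy : y ∈ (chartAt E x).target) (v : E) :
    ContMDiffAt 𝓘(ℝ, E) 𝓘(ℝ, E).tangent ∞ (fun z : E =>
      (⟨(chartAt E x).symm z, mfderiv 𝓘(ℝ, E) 𝓘(ℝ, E) (chartAt E x).symm z v⟩ :
        TangentBundle 𝓘(ℝ, E) M)) y := by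
  have ho := (chartAt E x).open_target
  have h1 : ContMDiffOn 𝓘(ℝ, E) 𝓘(ℝ, E) ∞ (chartAt E x).symm (chartAt E x).target :=
    fun z hz => (contMDiffAt_chart_symm hz).contMDiffWithinAt
  have h2 := h1.contMDiffOn_tangentMapWithin (m := ∞) (by simp) ho.uniqueMDiffOn
  have h3 : ContMDiffAt 𝓘(ℝ, E) 𝓘(ℝ, E).tangent ∞
      (fun z : E => (⟨z, v⟩ : TangentBundle 𝓘(ℝ, E) E)) y :=
    contMDiffAt_vectorSpace_iff_contDiffAt.2 contDiffAt_const
  have h4 : ContMDiffAt 𝓘(ℝ, E) 𝓘(ℝ, E).tangent ∞ (fun z : E => tangentMapWithin 𝓘(ℝ, E) 𝓘(ℝ, E)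
      (chartAt E x).symm (chartAt E x).target (⟨z, v⟩ : TangentBundle 𝓘(ℝ, E) E)) y := by
    refine ContMDiffWithinAt.contMDiffAt (s := (chartAt E x).target) ?_ (ho.mem_nhds hy)
    exact (h2 ⟨y, v⟩ hy).comp y h3.contMDiffWithinAt fun z hz => hz
  refine h4.congr_of_eventuallyEq ?_
  filter_upwards [ho.mem_nhds hy] with z hz
  simp only [tangentMapWithin]
  rw [mfderivWithin_of_isOpen ho hz]

theorem contDiffOn_metricInChart [FiniteDimensional ℝ E] (g : Metric E M) (x : M) :
    ContDiffOn ℝ ∞ (metricInChart g x) (chartAt E x).target := by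
  rw [contDiffOn_clm_apply]
  intro v
  rw [contDiffOn_clm_apply]
  intro w y hy
  refine ContDiffAt.contDiffWithinAt ?_
  rw [← contMDiffAt_iff_contDiffAt]
  have hb : ContMDiffAt 𝓘(ℝ, E) 𝓘(ℝ, E) ∞ (chartAt E x).symm y := contMDiffAt_chart_symm hy
  have : ContMDiffAt 𝓘(ℝ, E) (𝓘(ℝ, E).prod 𝓘(ℝ, ℝ)) ∞
      (fun z => Bundle.TotalSpace.mk' ℝ (E := Bundle.Trivial M ℝ) ((chartAt E x).symm z)
        (g.inner ((chartAt E x).symm z) (mfderiv 𝓘(ℝ, E) 𝓘(ℝ, E) (chartAt E x).symm z v)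
          (mfderiv 𝓘(ℝ, E) 𝓘(ℝ, E) (chartAt E x).symm z w))) y := by
    apply ContMDiffAt.clm_bundle_apply₂ (F₁ := E) (F₂ := E)
    · exact ContMDiffAt.comp y g.contMDiff.contMDiffAt hb
    · exact contMDiffAt_chart_symm_section hy v
    · exact contMDiffAt_chart_symm_section hy w
  simp only [Bundle.contMDiffAt_totalSpace] at this
  exact this.2

variable {G : Type*} [Group G] [MulAction G M]

theorem metricAt_smul {g : Metric E M} (hg : IsInvariantMetric G g) (a : G) (x : M) (v w : E) :
    metricAt g (a • x) (mfd E E (fun y : M => a • y) x v) (mfd E E (fun y : M => a • y) x w) =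
      metricAt g x v w := hg a x v w

end MetricInChart

/-! ### Fundamental vector fields of isometric actions -/

section Killing

open scoped Topology

variable {V : Type*} [NormedAddCommGroup V] [NormedSpace ℝ V]
  {K : Type*} [TopologicalSpace K] [ChartedSpace V K] [Group K] [LieGroup 𝓘(ℝ, V) ∞ K]
  {E : Type*} [NormedAddCommGroup E] [NormedSpace ℝ E] [FiniteDimensional ℝ E]
  {M : Type*} [TopologicalSpace M] [ChartedSpace E M] [IsManifold 𝓘(ℝ, E) ∞ M]

/-- The Killing equation for the fundamental vector fields of an isometric action, in a chart. -/
theorem IsSmoothAction.killing {act : K → M → M} (h : IsSmoothAction V E act) {g : Metric E M}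
    (hg : ∀ k x v w, metricAt g (act k x) (mfd E E (act k) x v) (mfd E E (act k) x w) =
      metricAt g x v w) (x₀ : M) (X : V) {y : E} (hy : y ∈ (chartAt E x₀).target) (v w : E) :
    fderiv ℝ (metricInChart g x₀) y (fieldInChart V E act x₀ X y) v w +
      metricInChart g x₀ y (fderiv ℝ (fieldInChart V E act x₀ X) y v) w +
      metricInChart g x₀ y v (fderiv ℝ (fieldInChart V E act x₀ X) y w) = 0 := by
  set F := actChart V E act x₀ with hF
  set e := oneChart V K with he
  have hFy : ContDiffAt ℝ ∞ F (e, y) := h.contDiffAt_actChart_one hy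
  have hFe : F (e, y) = y := h.actChart_one hy
  -- the isometry property in charts, for group elements near the unit
  have hconst : (fun u => metricInChart g x₀ (F (u, y)) (fderiv ℝ F (u, y) (0, v))
      (fderiv ℝ F (u, y) (0, w))) =ᶠ[𝓝 e] fun _ => metricInChart g x₀ y v w := by
    filter_upwards [h.eventually_act_mem ((chartAt E x₀).map_target hy),
      chart_target_mem_nhds (V := V) (K := K)] with u hu1 hu
    rw [hF, actChart, fderiv_inCharts_right hu hy h.contMDiff.contMDiffAt hu1,
      fderiv_inCharts_right hu hy h.contMDiff.contMDiffAt hu1]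
    refine (metricInChart_chart g hu1 _ _).trans ?_
    rw [metricInChart_apply]
    exact hg _ _ _ _
  have hp : HasFDerivAt (fun u : V => (u, y)) ((ContinuousLinearMap.id ℝ V).prod 0) e :=
    (hasFDerivAt_id e).prodMk (hasFDerivAt_const y e)
  have hd : ∀ v : E, HasFDerivAt (fun u => fderiv ℝ F (u, y) (0, v)) _ e := fun v =>
    hasFDerivAt_fderiv_apply (F := F) (p := fun u : V => (u, y)) (w := fun _ => ((0 : V), v))
      hFy hp (hasFDerivAt_const _ e)
  have hG : HasFDerivAt (metricInChart g x₀) (fderiv ℝ (metricInChart g x₀) y) (F (e, y)) := by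
    rw [hFe]
    exact (((contDiffOn_metricInChart g x₀).contDiffAt
      ((chartAt E x₀).open_target.mem_nhds hy)).differentiableAt (by simp)).hasFDerivAt
  have hFu : HasFDerivAt (fun u => F (u, y)) ((fderiv ℝ F (e, y)).comp
      ((ContinuousLinearMap.id ℝ V).prod 0)) e :=
    HasFDerivAt.comp e (f := fun u => (u, y)) (hFy.differentiableAt (by simp)).hasFDerivAt hp
  have hGF := HasFDerivAt.comp e (f := fun u => F (u, y)) hG hFu
  have hall := (hGF.clm_apply (hd v)).clm_apply (hd w)
  have h0 := congrArg (fun T : V →L[ℝ] ℝ => T X)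
    ((hall.congr_of_eventuallyEq hconst.symm).unique (hasFDerivAt_const _ e))
  have hv : ∀ v, fderiv ℝ F (e, y) (0, v) = v := fun v => h.fderiv_actChart_right hy v
  have hfield : fderiv ℝ F (e, y) (X, 0) = fieldInChart V E act x₀ X y := rfl
  simp [hFe, hv, hfield] at h0
  rw [h.fderiv_fieldInChart hy, h.fderiv_fieldInChart hy]
  rw [← h0]
  ring
end Killing

/-! ### The Ricci curvature of homogeneous metrics -/

section Homogeneous

variable {EG : Type*} [NormedAddCommGroup EG] [NormedSpace ℝ EG]
  {G : Type*} [TopologicalSpace G] [ChartedSpace EG G] [Group G]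
  {EM : Type*} [NormedAddCommGroup EM] [NormedSpace ℝ EM]
  {M : Type*} [TopologicalSpace M] [ChartedSpace EM M]
  [MulAction G M] [ContMDiffSMul 𝓘(ℝ, EG) 𝓘(ℝ, EM) ∞ G M]
  {K : Subgroup G} {EK : Type*} [NormedAddCommGroup EK] [NormedSpace ℝ EK] [ChartedSpace EK K]

variable (M) in
/-- The action on `M` of a subgroup of `G`. -/
def subAct (K : Subgroup G) (k : K) (x : M) : M := (k : G) • x

theorem isSmoothAction_subAct (hK : ContMDiff 𝓘(ℝ, EK) 𝓘(ℝ, EG) ∞ (K.subtype : K → G)) :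
    IsSmoothAction EK EM (subAct M K) where
  one_act x := one_smul G x
  mul_act a b x := mul_smul (a : G) b x
  contMDiff := (contMDiff_smul (I := 𝓘(ℝ, EG)) (I' := 𝓘(ℝ, EM)) (n := ∞)).comp
    ((hK.comp contMDiff_fst).prodMk contMDiff_snd)

variable [FiniteDimensional ℝ EG] [LieGroup 𝓘(ℝ, EG) ∞ G] [FiniteDimensional ℝ EK]
  [LieGroup 𝓘(ℝ, EK) ∞ K]

/-- The ambient group permutes the fundamental vector fields of a normal subgroup, through the
derivatives of its conjugations. -/
theorem fundField_smul [K.Normal]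
    (hK : ContMDiff 𝓘(ℝ, EK) 𝓘(ℝ, EG) ∞ (K.subtype : K → G)) (a : G) (x : M) (X : EK) :
    fundField EK EM (subAct M K) X (a • x) = mfd EM EM (fun y : M => a • y) x
      (fundField EK EM (subAct M K)
        (mfd EK EK (fun k : K => MulAut.conjNormal a⁻¹ k) 1 X) x) := by
  have h := isSmoothAction_subAct (EM := EM) (M := M) hK
  have h1 : MDifferentiableAt 𝓘(ℝ, EK) 𝓘(ℝ, EK) (fun k : K => MulAut.conjNormal a⁻¹ k) 1 :=
    (isSmoothAction_conjNormal hK).mdifferentiableAt_right a⁻¹ 1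
  have h2 := h.mdifferentiableAt_left x (MulAut.conjNormal a⁻¹ (1 : K))
  have e1 := mfd_comp_apply (g := fun k => subAct M K k x)
    (f := fun k : K => MulAut.conjNormal a⁻¹ k) h2 h1 X
  have hs : MDifferentiableAt 𝓘(ℝ, EM) 𝓘(ℝ, EM) (fun y : M => a • y)
      (subAct M K (MulAut.conjNormal a⁻¹ (1 : K)) x) :=
    (contMDiffAt_right (f := fun (a : G) (y : M) => a • y) (contMDiff_smul (I := 𝓘(ℝ, EG))
      (I' := 𝓘(ℝ, EM)) (n := ∞)).contMDiffAt).mdifferentiableAt (by simp)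
  have e2 := mfd_comp_apply (g := fun y : M => a • y)
    (f := fun k : K => subAct M K (MulAut.conjNormal a⁻¹ k) x)
    hs (MDifferentiableAt.comp (1 : K) h2 h1) X
  have e3 : subAct M K (MulAut.conjNormal a⁻¹ (1 : K)) x = x := by rw [map_one]; exact h.one_act x
  rw [e1, e3, map_one] at e2
  rw [fundField, fundField, ← e2]
  congr 2
  funext k
  simp only [subAct, MulAut.conjNormal_apply, ← mul_smul]
  congr 1
  group

variable [FiniteDimensional ℝ EM] [IsManifold 𝓘(ℝ, EM) ∞ M] [MulAction.IsPretransitive G M]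

/-- If the Lie algebra of a compact normal subgroup is not abelian, then some of its fundamental
vector fields have a total Ricci curvature which is bounded below by a positive constant that is
the same for all homogeneous metrics. -/
theorem exists_pos_le_sum_ricci [Nonempty M] [K.Normal] [CompactSpace K]
    (hGM : IsAlmostEffective G M)
    (hK : ContMDiff 𝓘(ℝ, EK) 𝓘(ℝ, EG) ∞ (K.subtype : K → G))
    (hna : ∃ X Y : EK, chartBracket K X Y ≠ 0) :
    ∃ (n : ℕ) (X : Fin n → EK) (c : ℝ), 0 < c ∧ ∀ g : Metric EM M, IsInvariantMetric G g →
      ∀ x : M, c ≤ ∑ i, ricci g x (fundField EK EM (subAct M K) (X i) x)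
        (fundField EK EM (subAct M K) (X i) x) := by
  have : CompleteSpace EK := FiniteDimensional.complete ℝ EK
  have h := isSmoothAction_subAct (EM := EM) (M := M) hK
  obtain ⟨n, X, a, hbr, ⟨i₀, hi₀⟩, hsum⟩ := exists_frame hna
  -- the sign is due to `fieldInChart_bracket`
  obtain ⟨c, hc, hric⟩ := exists_pos_le_sum_coordRicci fun l i j => -a l i j
  refine ⟨n, X, c, hc, fun g hg x => ?_⟩
  -- the sum of the squared lengths of the fields is constant on `M`
  let f : M → ℝ := fun y => ∑ i, metricAt g y (fundField EK EM (subAct M K) (X i) y)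
    (fundField EK EM (subAct M K) (X i) y)
  have hf : ∀ y, f y = f x := by
    intro y
    obtain ⟨b, rfl⟩ := MulAction.exists_smul_eq G x y
    obtain ⟨hc1, hc2⟩ := contMDiff_conjNormal hK b⁻¹
    let ev : EK →L[ℝ] EM := mfd EK EM (fun k => subAct M K k x) 1
    refine Eq.trans (Finset.sum_congr rfl fun i _ => ?_)
      (hsum _ hc1 hc2 ((metricAt g x).bilinearComp ev ev))
    rw [fundField_smul hK, metricAt_smul hg]
    rfl
  have hfield : ∀ (Z : EK), fieldInChart EK EM (subAct M K) x Z (chartAt EM x x) =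
      mfd EM EM (chartAt EM x) x (fundField EK EM (subAct M K) Z x) := by
    intro Z
    rw [h.fieldInChart_eq (mem_chart_target EM x), (chartAt EM x).left_inv (mem_chart_source EM x)]
  have hlen : ∀ y ∈ (chartAt EM x).target, ∑ i, metricInChart g x y
      (fieldInChart EK EM (subAct M K) x (X i) y)
      (fieldInChart EK EM (subAct M K) x (X i) y) = f x := by
    intro y hy
    rw [← hf ((chartAt EM x).symm y)]
    refine Finset.sum_congr rfl fun i _ => ?_
    rw [h.fieldInChart_eq hy, ← metricInChart_chart g ((chartAt EM x).map_target hy),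
      (chartAt EM x).right_inv hy]
  have := hric (chartAt EM x).open_target (fun y _ => metricInChart_symm g x y)
    (fun y hy v hv => metricInChart_pos g hy hv) (contDiffOn_metricInChart g x)
    (ξ := fun i => fieldInChart EK EM (subAct M K) x (X i))
    (fun i => h.contDiffOn_fieldInChart x (X i))
    (fun i y hy v w => h.killing (fun k y v w => metricAt_smul hg (k : G) y v w) x (X i) hy v w)
    hlen (mem_chart_target EM x) (fun l => ?_) ?_
  · simp only [hfield] at this
    exact this
  · have h2 : ∀ Z : EK, fieldInChart EK EM (subAct M K) x Z (chartAt EM x x) =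
        (fderiv ℝ (actChart EK EM (subAct M K) x) (oneChart EK K, chartAt EM x x)).comp
          (ContinuousLinearMap.inl ℝ EK EM) Z := fun Z => rfl
    rw [h2, hbr l]
    simp only [map_sum, map_smul]
    refine Finset.sum_congr rfl fun i _ => Finset.sum_congr rfl fun j _ => ?_
    rw [← h2, h.fieldInChart_bracket (mem_chart_target EM x), neg_smul, ← smul_neg, neg_sub]
  · -- otherwise all the fields vanish on `M`, and the ineffective kernel is infinite
    by_contra! hz
    have hfx : f x = 0 := by
      rw [← hlen _ (mem_chart_target EM x)]
      exact Finset.sum_eq_zero fun i _ => by rw [hz i]; simp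
    refine h.infinite_kernel (X := X i₀) hi₀ (fun y => ?_) ?_
    · have h0 : f y = 0 := (hf y).trans hfx
      by_contra hne
      have hnn : ∀ v : EM, 0 ≤ metricAt g y v v := by
        intro v
        by_cases hv : v = 0
        · simp [hv]
        · exact (metricAt_pos g y hv).le
      have := (Finset.sum_eq_zero_iff_of_nonneg fun i _ => hnn _).1 h0 i₀ (Finset.mem_univ _)
      exact (metricAt_pos g y hne).ne' this
    · exact Set.Finite.preimage (f := fun k : K => (k : G)) Subtype.val_injective.injOn hGM

/-- Under the Ricci flow, the sum of the squared lengths of the fields at a point decreases at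
least at the rate `2 * c`, while it remains nonnegative. -/
theorem hasFiniteExtinctionTime [Nonempty M] [K.Normal] [CompactSpace K]
    (hGM : IsAlmostEffective G M)
    (hK : ContMDiff 𝓘(ℝ, EK) 𝓘(ℝ, EG) ∞ (K.subtype : K → G))
    (hna : ∃ X Y : EK, chartBracket K X Y ≠ 0) (g₀ : Metric EM M) :
    HasFiniteExtinctionTime G g₀ := by
  obtain ⟨n, X, c, hc, hric⟩ := exists_pos_le_sum_ricci (EM := EM) hGM hK hna
  obtain ⟨x⟩ := ‹Nonempty M›
  let v : Fin n → EM := fun i => fundField EK EM (subAct M K) (X i) x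
  let ℓ : Metric EM M → ℝ := fun g => ∑ i, metricAt g x (v i) (v i)
  have hℓ : ∀ g, 0 ≤ ℓ g := fun g => Finset.sum_nonneg fun i _ => by
    by_cases hv : v i = 0
    · simp [hv]
    · exact (metricAt_pos g x hv).le
  refine ⟨ℓ g₀ / (2 * c), fun T g hg hg0 => le_of_forall_lt_imp_le_of_dense fun t ht => ?_⟩
  -- the time interval may be empty
  rcases lt_or_ge t 0 with ht0 | ht0
  · exact ht0.le.trans (div_nonneg (hℓ g₀) (by positivity))
  have hderiv : ∀ s ∈ Set.Ico 0 T, HasDerivWithinAt (fun s => ℓ (g s) + 2 * c * s)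
      (∑ i, -2 * ricci (g s) x (v i) (v i) + 2 * c) (Set.Ico 0 T) s := by
    intro s hs
    have h1 : HasDerivWithinAt (fun s => ∑ i, metricAt (g s) x (v i) (v i))
        (∑ i, -2 * ricci (g s) x (v i) (v i)) (Set.Ico 0 T) s :=
      HasDerivWithinAt.fun_sum fun i _ => hg.1 s hs x (v i) (v i)
    exact h1.add (((hasDerivAt_id s).const_mul (2 * c)).hasDerivWithinAt.congr_deriv (by simp))
  have hanti : AntitoneOn (fun s => ℓ (g s) + 2 * c * s) (Set.Ico 0 T) := by
    have hat : ∀ s ∈ interior (Set.Ico 0 T), HasDerivAt (fun s => ℓ (g s) + 2 * c * s)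
        (∑ i, -2 * ricci (g s) x (v i) (v i) + 2 * c) s := fun s hs =>
      (hderiv s (interior_subset hs)).hasDerivAt (mem_interior_iff_mem_nhds.1 hs)
    refine antitoneOn_of_deriv_nonpos (convex_Ico 0 T)
      (fun s hs => (hderiv s hs).continuousWithinAt)
      (fun s hs => (hat s hs).differentiableAt.differentiableWithinAt) fun s hs => ?_
    rw [(hat s hs).deriv, ← Finset.mul_sum]
    have := hric (g s) (hg.2 s (interior_subset hs)) x
    linarith
  have hle := hanti ⟨le_rfl, ht0.trans_lt ht⟩ ⟨ht0, ht⟩ ht0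
  simp only [mul_zero, add_zero, hg0] at hle
  rw [le_div_iff₀ (by positivity)]
  linarith [hℓ (g t)]

end Homogeneous

end HomRicci

theorem mainTheorem1
    -- the Lie group `G`
    {EG : Type*} [NormedAddCommGroup EG] [NormedSpace ℝ EG] [FiniteDimensional ℝ EG]
    {G : Type*} [TopologicalSpace G] [SecondCountableTopology G] [ChartedSpace EG G]
    [Group G] [LieGroup 𝓘(ℝ, EG) ∞ G]
    -- the homogeneous space `M = G/H`, `H` being the isotropy group of a point
    {EM : Type*} [NormedAddCommGroup EM] [NormedSpace ℝ EM] [FiniteDimensional ℝ EM]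
    {M : Type*} [TopologicalSpace M] [T2Space M] [ConnectedSpace M] [ChartedSpace EM M]
    [IsManifold 𝓘(ℝ, EM) ∞ M]
    [MulAction G M] [ContMDiffSMul 𝓘(ℝ, EG) 𝓘(ℝ, EM) ∞ G M] [MulAction.IsPretransitive G M]
    (hGM : HomRicci.IsAlmostEffective G M)
    -- the compact normal (Lie) subgroup `K`, with the subspace topology
    (K : Subgroup G) (hKn : K.Normal) (hKc : IsCompact (K : Set G))
    {EK : Type*} [NormedAddCommGroup EK] [NormedSpace ℝ EK] [FiniteDimensional ℝ EK]
    [ChartedSpace EK K] [LieGroup 𝓘(ℝ, EK) ∞ K]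
    (hK : ContMDiff 𝓘(ℝ, EK) 𝓘(ℝ, EG) ∞ (K.subtype : K → G)) :
    ((∃ a b : K, a * b ≠ b * a) → (ConnectedSpace K ∨ ConnectedSpace G) →
      ∀ g₀ : HomRicci.Metric EM M, HomRicci.IsInvariantMetric G g₀ →
        HomRicci.HasFiniteExtinctionTime G g₀) ∧
    (∀ g : ℝ → HomRicci.Metric EM M, HomRicci.IsImmortalHomogeneousRicciFlow G g →
      ¬ (Nontrivial (GroupLieAlgebra 𝓘(ℝ, EK) K) ∧
        LieAlgebra.IsSemisimple ℝ (GroupLieAlgebra 𝓘(ℝ, EK) K))) := by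
  have := hKn
  have : CompactSpace K := isCompact_iff_compactSpace.1 hKc
  have : Nonempty M := inferInstance
  have : CompleteSpace EK := FiniteDimensional.complete ℝ EK
  refine ⟨fun hna hconn g₀ _ => HomRicci.hasFiniteExtinctionTime hGM hK ?_ g₀,
    fun g hg ⟨hnt, hss⟩ => ?_⟩
  · by_contra! h0
    obtain ⟨a, b, hab⟩ := hna
    refine hab ?_
    rcases hconn with hc | hc
    · have h : HomRicci.IsSmoothAction EK EK (fun a k : K => a * k * a⁻¹) :=
        ⟨fun k => by simp, fun a b k => by group, HomRicci.contMDiff_conj_uncurry⟩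
      exact HomRicci.mul_comm_of_chartBracket_eq_zero h (fun a k l => by group)
        (fun k => ⟨k, fun _ => rfl⟩) h0 a b
    · exact HomRicci.mul_comm_of_chartBracket_eq_zero (HomRicci.isSmoothAction_conjNormal hK)
        (fun a k l => map_mul _ k l)
        (fun k => ⟨k, fun x => Subtype.ext (MulAut.conjNormal_apply (k : G) x)⟩) h0 a b
  · -- a semisimple Lie algebra whose bracket vanishes is zero
    have hna : ∃ X Y : EK, HomRicci.chartBracket K X Y ≠ 0 := by
      by_contra! h0
      have : IsLieAbelian (GroupLieAlgebra 𝓘(ℝ, EK) K) :=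
        ⟨fun X Y => (HomRicci.lie_eq_chartBracket X Y).trans (h0 X Y)⟩
      have := LieAlgebra.subsingleton_of_hasTrivialRadical_lie_abelian (R := ℝ)
        (L := GroupLieAlgebra 𝓘(ℝ, EK) K)
      exact not_subsingleton (GroupLieAlgebra 𝓘(ℝ, EK) K) this
    obtain ⟨T₀, hT₀⟩ := HomRicci.hasFiniteExtinctionTime hGM hK hna (g 0)
    have hsub : Set.Ico 0 (T₀ + 1) ⊆ Set.Ici (0 : ℝ) := fun t ht => ht.1
    have := hT₀ (T₀ + 1) g
      ⟨fun t ht x v w => (hg.1 t (hsub ht) x v w).mono hsub, fun t ht => hg.2 t (hsub ht)⟩ rfl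
    linarith
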